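/- Let $L$ be a first-order signature; structures are nonempty. A *separation rule* for $L$ is either a first-order $L$-sentence, or a monadic second-order sentence $$\forall x_1\cdots x_N\Big(\mu(\vec x)\rightarrow \exists C_1\cdots C_K\big(\eta(\vec x)\wedge \bigwedge_{i\in I}\forall y_1\cdots y_{M_i}(\gamma_i(\vec y)\rightarrow\psi_i(\vec y))\big)\Big),$$ where $1\le K<\omega$, the $C_k$ are unary predicate variables, $\mu$ and the $\gamma_i$ are first-order $L$-formulas, $\eta$ and the $\psi_i$ are quantifier-free first-order formulas in the signature $L\cup\{C_1,\dots,C_K\}$, and $I$ is any set (possibly infinite; for $I=\emptyset$ the conjunction is $\top$). The rule is *finite* if it is a first-order sentence or $I$ is finite. A *separation scheme* is a set $\Sigma$ of separation rules. It is *essentially finite* if it is a finite set of finite rules. When $L$ is an effective signature (its symbols are numbered so that it is decidable whether a number is that of a symbol of given arity), $\Sigma$ is *essentially r.e.* if $\Sigma=\{\sigma_n:n\in\omega\}$ where one algorithm computes from $n$ the finite part of $\sigma_n$ (the sentence $\sigma_n$, or $N,K,\mu,\eta$), and one algorithm, given $n$, lists the conjuncts of the infinitary conjunction in $\sigma_n$.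 For an elementary class $\mathcal A$ of $L$-structures let $\mathbf S_{\mathcal A}$, $\mathbf{RS}_{\mathcal A}$, $\mathbf{FS}_{\mathcal A}$ be the collections of those subclasses of $\mathcal A$ that have the form $\{A\in\mathcal A: A\models\Sigma\}$ (standard second-order semantics) for, respectively, an arbitrary, an essentially r.e., an essentially finite separation scheme $\Sigma$. Let $\mathbf E_{\mathcal A}$ be the collection of elementary subclasses of $\mathcal A$, and let $\mathbf{RE}_{\mathcal A}$, $\mathbf{FE}_{\mathcal A}$ be the collections of subclasses $\{A\in\mathcal A:A\models T\}$ with $T$ a recursive, respectively a finite, set of first-order $L$-sentences. Then the following inclusions hold for every elementary class $\mathcal A$ (those involving $\mathbf{RS}$ or $\mathbf{RE}$ for every effective signature, the others for every signature): $$\mathbf{FE}_{\mathcal A}\subseteq\mathbf{FS}_{\mathcal A}\subseteq\mathbf{RS}_{\mathcal A}\subseteq\mathbf S_{\mathcal A},\qquad \mathbf{FE}_{\mathcal A}\subseteq\mathbf{RE}_{\mathcal A}\subseteq\mathbf E_{\mathcal A},\qquad \mathbf{FS}_{\mathcal A}\subseteq\mathbf S_{\mathcal A},\qquad \mathbf{FE}_{\mathcal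 A}\subseteq\mathbf E_{\mathcal A},$$ $$\mathbf{RS}_{\mathcal A}=\mathbf{RE}_{\mathcal A},\qquad \mathbf S_{\mathcal A}=\mathbf E_{\mathcal A}.$$ Moreover, no other inclusion between two of these six collections holds in general: for any two of them, $\mathbf X$ and $\mathbf Y$, such that $\mathbf X_{\mathcal A}\subseteq\mathbf Y_{\mathcal A}$ does not follow from the inclusions above by transitivity, there are an effective signature and an elementary class $\mathcal A$ of structures for it with $\mathbf X_{\mathcal A}\not\subseteq\mathbf Y_{\mathcal A}$. In particular, essentially finite separation subclasses need not be finitely axiomatisable relative to $\mathcal A$. -/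

import Mathlib

universe u v w

namespace SeparationClass

open scoped FirstOrder

/-- The `L`-structures with carrier in `Type w`; carriers are nonempty, as is usual in first-order
logic (these are the nonempty models of the empty theory). -/
abbrev Struc (L : FirstOrder.Language.{u, v}) :=
  FirstOrder.Language.Theory.ModelType.{u, v, w} (∅ : L.Theory)

/-- First-order `L`-formulas whose free variables are among `x_0, …, x_(n-1)`. -/
abbrev Fml (L : FirstOrder.Language.{u, v}) (n : ℕ) := L.BoundedFormula Empty n

/-- `L`-terms whose variables are among `x_0, …, x_(n-1)`. -/
abbrev Trm (L : FirstOrder.Language.{u, v}) (n : ℕ) := L.Term (Empty ⊕ Fin n)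

/-- Satisfaction of a first-order formula `φ(x_0, …, x_(n-1))` by a tuple. -/
def Holds {L : FirstOrder.Language.{u, v}} {n : ℕ} (A : Struc.{u, v, w} L) (φ : Fml L n) (a : Fin n → A) :
    Prop :=
  φ.Realize default a

/-- The value of a term at a tuple. -/
def value {L : FirstOrder.Language.{u, v}} {n : ℕ} (A : Struc.{u, v, w} L) (t : Trm L n) (a : Fin n → A) : A :=
  t.realize (Sum.elim default a)

/-! ### Separation rules and separation schemes -/

/-- Quantifier-free first-order formulas, with variables among `x_0, …, x_(n-1)`, in the signature
`L ∪ {C_0, …, C_(K-1)}` where the `C_k` are new unary predicate symbols. (The `C_k` add no terms;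
`⊥` and `→` generate the other connectives.) -/
inductive QF (L : FirstOrder.Language.{u, v}) (K n : ℕ) : Type (max u v)
  | falsum : QF L K n
  | equal (s t : Trm L n) : QF L K n
  | rel {l : ℕ} (R : L.Relations l) (ts : Fin l → Trm L n) : QF L K n
  | mem (k : Fin K) (t : Trm L n) : QF L K n
  | imp (φ ψ : QF L K n) : QF L K n

/-- Satisfaction of a quantifier-free formula, the predicate `C_k` being interpreted by `S k`. -/
def QF.Holds {L : FirstOrder.Language.{u, v}} {K n : ℕ} (A : Struc.{u, v, w} L) (S : Fin K → Set A)
    (a : Fin n → A) : QF L K n → Prop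
  | .falsum => False
  | .equal s t => value A s a = value A t a
  | .rel R ts => FirstOrder.Language.Structure.RelMap R fun i => value A (ts i) a
  | .mem k t => value A t a ∈ S k
  | .imp φ ψ => QF.Holds A S a φ → QF.Holds A S a ψ

/-- A conjunct `∀ y_0 … y_(m-1) (γ → ψ)` of a closure rule: `γ` is a first-order `L`-formula and `ψ`
is quantifier-free in `L ∪ {C_0, …, C_(K-1)}`. -/
structure Clause (L : FirstOrder.Language.{u, v}) (K : ℕ) : Type (max u v) where
  arity : ℕ
  γ : Fml L arity
  ψ : QF L K arity

def Clause.Holds {L : FirstOrder.Language.{u, v}} {K : ℕ} (A : Struc.{u, v, w} L) (S : Fin K → Set A)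
    (c : Clause L K) : Prop :=
  ∀ b : Fin c.arity → A, SeparationClass.Holds A c.γ b → c.ψ.Holds A S b

/-- Separation rules: either first-order sentences (order zero), or monadic second-order sentences
`∀ x_0 … x_(N-1) (μ → ∃ C_0 … C_(K-1) (η ∧ ⋀ τ))` with `1 ≤ K`, where `τ` is any set of clauses,
possibly infinite; the empty `τ` is the case in which the closure rule is the tautology `⊤`. -/
inductive SepRule (L : FirstOrder.Language.{u, v}) : Type (max u v)
  | sentence (φ : L.Sentence) : SepRule L
  | rule (N K : ℕ) (hK : 1 ≤ K) (μ : Fml L N) (η : QF L K N) (τ : Set (Clause L K)) : SepRule L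

/-- Standard second-order semantics of separation rules. -/
def SepRule.Holds {L : FirstOrder.Language.{u, v}} (A : Struc.{u, v, w} L) : SepRule L → Prop
  | .sentence φ => A ⊨ φ
  | .rule N K _ μ η τ => ∀ a : Fin N → A, SeparationClass.Holds A μ a →
      ∃ S : Fin K → Set A, η.Holds A S a ∧ ∀ c ∈ τ, c.Holds A S

/-- A separation rule is finite if it has order zero or its closure rule is a finite conjunction
(or `⊤`). -/
def SepRule.IsFinite {L : FirstOrder.Language.{u, v}} : SepRule L → Prop
  | .sentence _ => True
  | .rule _ _ _ _ _ τ => τ.Finite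

/-- The members of `𝒜` that satisfy the separation scheme `S`. -/
def definedBy {L : FirstOrder.Language.{u, v}} (𝒜 : Set (Struc.{u, v, w} L)) (S : Set (SepRule L)) :
    Set (Struc.{u, v, w} L) :=
  {A | A ∈ 𝒜 ∧ ∀ σ ∈ S, σ.Holds A}

/-- A separation scheme is essentially finite if it is a finite set of finite rules. -/
def EssFinite {L : FirstOrder.Language.{u, v}} (S : Set (SepRule L)) : Prop :=
  S.Finite ∧ ∀ σ ∈ S, σ.IsFinite

/-! ### Effective signatures and Gödel numbers -/

/-- An effective signature: the function and relation symbols of each arity are numbered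
injectively, and it is decidable whether a number is that of a symbol of a given arity. -/
class EffectiveSignature (L : FirstOrder.Language.{u, v}) where
  funCode : ∀ n : ℕ, L.Functions n → ℕ
  relCode : ∀ n : ℕ, L.Relations n → ℕ
  funCode_injective : ∀ n, Function.Injective (funCode n)
  relCode_injective : ∀ n, Function.Injective (relCode n)
  computable_fun : ComputablePred fun p : ℕ × ℕ => ∃ f : L.Functions p.1, funCode p.1 f = p.2
  computable_rel : ComputablePred fun p : ℕ × ℕ => ∃ R : L.Relations p.1, relCode p.1 R = p.2

section Codes

variable {L : FirstOrder.Language.{u, v}} [EffectiveSignature L]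

/-- The Gödel number of a term. -/
def termCode {n : ℕ} : Trm L n → ℕ
  | .var (.inl e) => e.elim
  | .var (.inr i) => 2 * i.val
  | .func (l := l) f ts =>
      2 * Nat.pair l (Nat.pair (EffectiveSignature.funCode l f)
        (Encodable.encode (List.ofFn fun i => termCode (ts i)))) + 1

/-- The Gödel number of an atomic formula `R(t_1, …, t_l)`. -/
def relAtomCode {n l : ℕ} (R : L.Relations l) (ts : Fin l → Trm L n) : ℕ :=
  Nat.pair l (Nat.pair (EffectiveSignature.relCode l R)
    (Encodable.encode (List.ofFn fun i => termCode (ts i))))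

/-- The Gödel number of a first-order formula. -/
def fmlCode : ∀ {n : ℕ}, Fml L n → ℕ
  | _, .falsum => 0
  | _, .equal s t => 4 * Nat.pair (termCode s) (termCode t) + 1
  | _, .rel R ts => 4 * relAtomCode R ts + 2
  | _, .imp φ ψ => 4 * Nat.pair (fmlCode φ) (fmlCode ψ) + 3
  | _, .all φ => 4 * fmlCode φ + 4

/-- The Gödel number of a quantifier-free formula in `L ∪ {C_0, …, C_(K-1)}`. -/
def QF.code {K n : ℕ} : QF L K n → ℕ
  | .falsum => 0
  | .equal s t => 4 * Nat.pair (termCode s) (termCode t) + 1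
  | .rel R ts => 4 * relAtomCode R ts + 2
  | .imp φ ψ => 4 * Nat.pair φ.code ψ.code + 3
  | .mem k t => 4 * Nat.pair k.val (termCode t) + 4

def Clause.code {K : ℕ} (c : Clause L K) : ℕ :=
  Nat.pair c.arity (Nat.pair (fmlCode c.γ) c.ψ.code)

/-- The Gödel number of the finite part of a separation rule (all of it except `τ`). -/
def SepRule.headCode : SepRule L → ℕ
  | .sentence φ => 2 * fmlCode φ
  | .rule N K _ μ η _ => 2 * Nat.pair N (Nat.pair K (Nat.pair (fmlCode μ) η.code)) + 1

/-- The Gödel numbers of the conjuncts of the closure rule of a separation rule. -/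
def SepRule.clauseCodes : SepRule L → Set ℕ
  | .sentence _ => ∅
  | .rule _ _ _ _ _ τ => {k | ∃ c ∈ τ, c.code = k}

/-- A separation scheme is essentially r.e. if it can be written `{σ_n : n ∈ ℕ}` so that one
algorithm computes the finite part of `σ_n` from `n`, and one algorithm lists, given `n`, the
conjuncts of the closure rule of `σ_n`. -/
def EssRE (S : Set (SepRule L)) : Prop :=
  ∃ σ : ℕ → SepRule L, S = Set.range σ ∧ (Computable fun n => (σ n).headCode) ∧
    REPred fun p : ℕ × ℕ => p.2 ∈ (σ p.1).clauseCodes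

/-- A set of first-order sentences is recursive. -/
def RecursiveTheory (T : L.Theory) : Prop :=
  ComputablePred fun k : ℕ => ∃ φ ∈ T, fmlCode (n := 0) φ = k

end Codes

/-! ### The families of subclasses -/

/-- A class of structures is elementary if it is the class of models of a first-order theory. -/
def IsElementary {L : FirstOrder.Language.{u, v}} (𝒜 : Set (Struc.{u, v, w} L)) : Prop :=
  ∃ T : L.Theory, 𝒜 = {A : Struc.{u, v, w} L | A ⊨ T}

section Subclasses

variable {L : FirstOrder.Language.{u, v}}

/-- Separation subclasses of `𝒜`. -/
def S (𝒜 : Set (Struc.{u, v, w} L)) : Set (Set (Struc.{u, v, w} L)) :=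
  {ℬ | ∃ Sch : Set (SepRule L), ℬ = definedBy 𝒜 Sch}

/-- Essentially r.e. separation subclasses of `𝒜`. -/
def RS [EffectiveSignature L] (𝒜 : Set (Struc.{u, v, w} L)) : Set (Set (Struc.{u, v, w} L)) :=
  {ℬ | ∃ Sch : Set (SepRule L), EssRE Sch ∧ ℬ = definedBy 𝒜 Sch}

/-- Essentially finite separation subclasses of `𝒜`. -/
def FS (𝒜 : Set (Struc.{u, v, w} L)) : Set (Set (Struc.{u, v, w} L)) :=
  {ℬ | ∃ Sch : Set (SepRule L), EssFinite Sch ∧ ℬ = definedBy 𝒜 Sch}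

/-- Elementary subclasses of `𝒜`. -/
def E (𝒜 : Set (Struc.{u, v, w} L)) : Set (Set (Struc.{u, v, w} L)) :=
  {ℬ | ℬ ⊆ 𝒜 ∧ IsElementary ℬ}

/-- Subclasses of `𝒜` with a recursive axiomatisation relative to `𝒜`. -/
def RE [EffectiveSignature L] (𝒜 : Set (Struc.{u, v, w} L)) : Set (Set (Struc.{u, v, w} L)) :=
  {ℬ | ∃ T : L.Theory, RecursiveTheory T ∧ ℬ = {A | A ∈ 𝒜 ∧ A ⊨ T}}

/-- Subclasses of `𝒜` that are finitely axiomatisable relative to `𝒜`. -/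
def FE (𝒜 : Set (Struc.{u, v, w} L)) : Set (Set (Struc.{u, v, w} L)) :=
  {ℬ | ∃ T : L.Theory, T.Finite ∧ ℬ = {A | A ∈ 𝒜 ∧ A ⊨ T}}

end Subclasses

/-! ### The diagram -/

/-- The six vertices of the diagram. -/
inductive Kind
  | FS | RS | S | FE | RE | E

/-- The arrows of the diagram. -/
inductive Arrow : Kind → Kind → Prop
  | FS_RS : Arrow .FS .RS
  | RS_S : Arrow .RS .S
  | FE_RE : Arrow .FE .RE
  | RE_E : Arrow .RE .E
  | FE_FS : Arrow .FE .FS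
  | RE_RS : Arrow .RE .RS
  | RS_RE : Arrow .RS .RE
  | E_S : Arrow .E .S
  | S_E : Arrow .S .E

/-- The family of subclasses of `𝒜` named by a vertex of the diagram. -/
def Kind.subclasses {L : FirstOrder.Language.{u, v}} [EffectiveSignature L] (X : Kind)
    (𝒜 : Set (Struc.{u, v, w} L)) : Set (Set (Struc.{u, v, w} L)) :=
  match X with
  | .FS => SeparationClass.FS 𝒜
  | .RS => SeparationClass.RS 𝒜
  | .S => SeparationClass.S 𝒜
  | .FE => SeparationClass.FE 𝒜
  | .RE => SeparationClass.RE 𝒜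
  | .E => SeparationClass.E 𝒜

end SeparationClass

/-! The positive half is an elimination of the second-order quantifier. For fixed parameters,
predicates `C_k` as demanded by a rule are a point of the product space `Fin K → A → Bool`, and `η`
and each instance of a clause whose premiss is true define clopen subsets of it. By compactness a
suitable point exists as soon as every finite set of these conditions can be met. A finite set of
conditions is one quantifier-free formula, which tests the `C_k` only at the values of finitely many
terms; its satisfiability is therefore a first-order property, namely a finite disjunction over the
possible sets of true atoms (`QF.holds_sat`). So a rule is equivalent to the set of its first-order
approximations, one for each finite list of clauses (`holds_rule_iff`), and `S_eq_E` follows.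

For the effective version, the code of an approximation is a primitive recursive function of the
code of the head and the codes of the listed clauses. An essentially r.e. scheme thus yields a
computable enumeration of sentences, and Craig's padding trick turns it into a recursive theory
(`RS_subset_RE`).

Up to the two equalities the diagram is a chain of four levels, FE, FS, RS = RE, S = E, so only the
three steps between neighbours must be shown strict. The class of all structures for one rich
signature serves each time: - FS is not in FE: "one constant is not reachable from another by
iterating `f`" is a single finite rule, but an ultraproduct shows that no finite theory expresses
it. - RE is not in FS: a finite scheme mentions finitely many symbols, so it cannot axiomatise "all
nullary relations hold". - E is not in RE: there are uncountably many elementary classes and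
countably many recursive theories. -/

namespace SeparationClass

open scoped FirstOrder

/-! ### Renaming of variables -/

section Renaming

variable {L : FirstOrder.Language.{u, v}}

/-- Renaming of the variables of a term. -/
def renameTerm {n n' : ℕ} (ρ : Fin n → Fin n') (t : Trm L n) : Trm L n' :=
  t.relabel (Sum.map id ρ)

/-- The extension of a renaming to one more variable. -/
def extendRenaming {n n' : ℕ} (ρ : Fin n → Fin n') : Fin (n + 1) → Fin (n' + 1) :=
  Fin.snoc (α := fun _ => Fin (n' + 1)) (fun i => (ρ i).castSucc) (Fin.last n')

/-- Renaming of the free variables of a first-order formula. -/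
def renameFml : ∀ {n n' : ℕ}, (Fin n → Fin n') → Fml L n → Fml L n'
  | _, _, _, .falsum => .falsum
  | _, _, ρ, .equal s t => .equal (renameTerm ρ s) (renameTerm ρ t)
  | _, _, ρ, .rel R ts => .rel R fun i => renameTerm ρ (ts i)
  | _, _, ρ, .imp φ ψ => .imp (renameFml ρ φ) (renameFml ρ ψ)
  | _, _, ρ, .all φ => .all (renameFml (extendRenaming ρ) φ)

/-- Renaming of the variables of a quantifier-free formula. -/
def QF.rename {K n n' : ℕ} (ρ : Fin n → Fin n') : QF L K n → QF L K n'
  | .falsum => .falsum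
  | .equal s t => .equal (renameTerm ρ s) (renameTerm ρ t)
  | .rel R ts => .rel R fun i => renameTerm ρ (ts i)
  | .mem k t => .mem k (renameTerm ρ t)
  | .imp φ ψ => .imp (φ.rename ρ) (ψ.rename ρ)

theorem value_renameTerm {n n' : ℕ} (A : Struc.{u, v, w} L) (ρ : Fin n → Fin n') (t : Trm L n)
    (a : Fin n' → A) : value A (renameTerm ρ t) a = value A t (a ∘ ρ) := by
  unfold value renameTerm
  rw [FirstOrder.Language.Term.realize_relabel]
  congr 1
  funext x
  cases x with
  | inl e => exact e.elim
  | inr i => rfl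

theorem snoc_comp_extendRenaming {n n' : ℕ} {A : Type w} (ρ : Fin n → Fin n') (a : Fin n' → A)
    (x : A) : (Fin.snoc a x : Fin (n' + 1) → A) ∘ extendRenaming ρ = Fin.snoc (a ∘ ρ) x := by
  funext i
  refine Fin.lastCases ?_ (fun i => ?_) i <;> simp [extendRenaming]

theorem holds_renameFml (A : Struc.{u, v, w} L) {n : ℕ} (φ : Fml L n) : ∀ {n' : ℕ}
    (ρ : Fin n → Fin n') (a : Fin n' → A), Holds A (renameFml ρ φ) a ↔ Holds A φ (a ∘ ρ) := by
  induction φ with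
  | falsum => intro _ _ _; exact Iff.rfl
  | equal s t =>
    intro n' ρ a
    exact iff_of_eq (congrArg₂ Eq (value_renameTerm A ρ s a) (value_renameTerm A ρ t a))
  | rel R ts =>
    intro n' ρ a
    exact iff_of_eq (congrArg (FirstOrder.Language.Structure.RelMap R)
      (funext fun i => value_renameTerm A ρ (ts i) a))
  | imp φ ψ hφ hψ => intro n' ρ a; exact imp_congr (hφ ρ a) (hψ ρ a)
  | all φ h =>
    intro n' ρ a
    refine forall_congr' fun x => (h (extendRenaming ρ) _).trans ?_
    rw [snoc_comp_extendRenaming]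
    rfl

theorem QF.holds_rename {K n n' : ℕ} (A : Struc.{u, v, w} L) (S : Fin K → Set A)
    (ρ : Fin n → Fin n') (a : Fin n' → A) (θ : QF L K n) :
    (θ.rename ρ).Holds A S a ↔ θ.Holds A S (a ∘ ρ) := by
  induction θ with
  | falsum => exact Iff.rfl
  | equal s t => simp only [QF.rename, QF.Holds, value_renameTerm]
  | rel R ts => simp only [QF.rename, QF.Holds, value_renameTerm]
  | mem k t => simp only [QF.rename, QF.Holds, value_renameTerm]
  | imp φ ψ hφ hψ => exact imp_congr hφ hψ

end Renaming

/-! ### Elimination of predicate variables from quantifier-free formulas -/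

section Elimination

variable {L : FirstOrder.Language.{u, v}} {K n : ℕ}

/-- The disjunction of a list of formulas. -/
def disj (l : List (Fml L n)) : Fml L n :=
  l.foldr (fun φ ψ => (φ.imp .falsum).imp ψ) .falsum

theorem holds_disj (A : Struc.{u, v, w} L) (l : List (Fml L n)) (a : Fin n → A) :
    Holds A (disj l) a ↔ ∃ φ ∈ l, Holds A φ a := by
  induction l with
  | nil => simp [disj, Holds, FirstOrder.Language.BoundedFormula.Realize]
  | cons φ l ih =>
    rw [List.exists_mem_cons_iff, ← ih]
    change ((Holds A φ a → False) → Holds A (disj l) a) ↔ _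
    tauto

/-- The formula saying that the value of `t` is the value of some `s` with `(k, s)` in `P`. -/
def memFml (P : List (Fin K × Trm L n)) (k : Fin K) (t : Trm L n) : Fml L n :=
  disj ((P.filter fun p => p.1 = k).map fun p => .equal t p.2)

/-- The predicates whose members are the values of the terms in a list. -/
def listedSets (A : Struc.{u, v, w} L) (P : List (Fin K × Trm L n)) (a : Fin n → A) (k : Fin K) :
    Set A :=
  {x | ∃ s, (k, s) ∈ P ∧ value A s a = x}

theorem holds_memFml (A : Struc.{u, v, w} L) (P : List (Fin K × Trm L n)) (k : Fin K)
    (t : Trm L n) (a : Fin n → A) :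
    Holds A (memFml P k t) a ↔ value A t a ∈ listedSets A P a k := by
  rw [memFml, holds_disj]
  constructor
  · rintro ⟨φ, hφ, h⟩
    obtain ⟨⟨k', s⟩, hp, rfl⟩ := List.mem_map.1 hφ
    obtain ⟨hp', hk⟩ := List.mem_filter.1 hp
    obtain rfl : k' = k := of_decide_eq_true hk
    exact ⟨s, hp', Eq.symm h⟩
  · rintro ⟨s, hs, h⟩
    exact ⟨_, List.mem_map.2 ⟨(k, s), List.mem_filter.2 ⟨hs, by simp⟩, rfl⟩, Eq.symm h⟩

/-- The formula obtained by interpreting the predicates by finite lists of terms. -/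
def QF.subst (P : List (Fin K × Trm L n)) : QF L K n → Fml L n
  | .falsum => .falsum
  | .equal s t => .equal s t
  | .rel R ts => .rel R ts
  | .mem k t => memFml P k t
  | .imp φ ψ => .imp (φ.subst P) (ψ.subst P)

theorem QF.holds_subst (A : Struc.{u, v, w} L) (P : List (Fin K × Trm L n)) (a : Fin n → A)
    (θ : QF L K n) : SeparationClass.Holds A (θ.subst P) a ↔ θ.Holds A (listedSets A P a) a := by
  induction θ with
  | falsum => exact Iff.rfl
  | equal s t => exact Iff.rfl
  | rel R ts => exact Iff.rfl
  | mem k t => exact holds_memFml A P k t a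
  | imp φ ψ hφ hψ => exact imp_congr hφ hψ

/-- The atoms `C_k(t)` that occur in a quantifier-free formula. -/
def QF.atoms : QF L K n → List (Fin K × Trm L n)
  | .falsum => []
  | .equal _ _ => []
  | .rel _ _ => []
  | .mem k t => [(k, t)]
  | .imp φ ψ => φ.atoms ++ ψ.atoms

/-- Only finitely many membership questions enter a quantifier-free formula. This locality reduces
the choice of arbitrary predicates to the choice of a set of atoms. -/
theorem QF.holds_congr (A : Struc.{u, v, w} L) {S S' : Fin K → Set A} (a : Fin n → A)
    (θ : QF L K n) (h : ∀ p ∈ θ.atoms, value A p.2 a ∈ S p.1 ↔ value A p.2 a ∈ S' p.1) :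
    θ.Holds A S a ↔ θ.Holds A S' a := by
  induction θ with
  | falsum => exact Iff.rfl
  | equal s t => exact Iff.rfl
  | rel R ts => exact Iff.rfl
  | mem k t => exact h (k, t) (by simp [QF.atoms])
  | imp φ ψ hφ hψ =>
    exact imp_congr (hφ fun p hp => h p (by simp [QF.atoms, hp]))
      (hψ fun p hp => h p (by simp [QF.atoms, hp]))

/-- The first-order formula saying that a quantifier-free formula holds for some choice of the
predicates. -/
def QF.sat (θ : QF L K n) : Fml L n :=
  disj (θ.atoms.sublists'.map fun P => θ.subst P)

theorem QF.holds_sat (A : Struc.{u, v, w} L) (a : Fin n → A) (θ : QF L K n) :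
    SeparationClass.Holds A θ.sat a ↔ ∃ S, θ.Holds A S a := by
  rw [QF.sat, holds_disj]
  constructor
  · rintro ⟨φ, hφ, h⟩
    obtain ⟨P, -, rfl⟩ := List.mem_map.1 hφ
    exact ⟨_, (θ.holds_subst A P a).1 h⟩
  · classical
    rintro ⟨S, h⟩
    -- The witness is the list of atoms true under `S`. The predicates it lists may be smaller than
    -- `S`, but they agree with `S` at every atom of `θ`.
    refine ⟨_, List.mem_map.2 ⟨θ.atoms.filter fun p => decide (value A p.2 a ∈ S p.1),
      List.mem_sublists'.2 List.filter_sublist, rfl⟩, ?_⟩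
    rw [QF.holds_subst, ← QF.holds_congr A (S := S) a θ]
    · exact h
    · rintro ⟨k, t⟩ hp
      constructor
      · intro hm
        exact ⟨t, List.mem_filter.2 ⟨hp, by simpa using hm⟩, rfl⟩
      -- The listed term `s` may differ from `t`; equality of their values suffices.
      · rintro ⟨s, hs, he⟩
        have := (List.mem_filter.1 hs).2
        simp only [decide_eq_true_eq] at this
        rwa [he] at this

end Elimination

/-! ### Finite approximations of a rule and compactness -/

section Approximation

variable {L : FirstOrder.Language.{u, v}} {K : ℕ}

/-- Conjunction of first-order formulas. -/
def andFml {n : ℕ} (φ ψ : Fml L n) : Fml L n := (φ.imp (ψ.imp .falsum)).imp .falsum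

/-- Conjunction of quantifier-free formulas. -/
def QF.and {n : ℕ} (φ ψ : QF L K n) : QF L K n := (φ.imp (ψ.imp .falsum)).imp .falsum

theorem holds_andFml {n : ℕ} (A : Struc.{u, v, w} L) (φ ψ : Fml L n) (a : Fin n → A) :
    Holds A (andFml φ ψ) a ↔ Holds A φ a ∧ Holds A ψ a := by
  change ((Holds A φ a → Holds A ψ a → False) → False) ↔ _
  tauto

theorem QF.holds_and {n : ℕ} (A : Struc.{u, v, w} L) (S : Fin K → Set A) (φ ψ : QF L K n)
    (a : Fin n → A) : (φ.and ψ).Holds A S a ↔ φ.Holds A S a ∧ ψ.Holds A S a := by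
  change ((φ.Holds A S a → ψ.Holds A S a → False) → False) ↔ _
  tauto

namespace Clause

/-- The conjunction, on disjoint variables, of the premisses and of the conclusions. -/
def conj (c d : Clause L K) : Clause L K where
  arity := c.arity + d.arity
  γ := andFml (renameFml (Fin.castAdd d.arity) c.γ) (renameFml (Fin.natAdd c.arity) d.γ)
  ψ := (c.ψ.rename (Fin.castAdd d.arity)).and (d.ψ.rename (Fin.natAdd c.arity))

/-- The sentence saying that, whenever the premiss of the clause holds of some elements, its
conclusion holds of them for some choice of the predicates. -/
def satSentence (c : Clause L K) : L.Sentence := (c.γ.imp c.ψ.sat).alls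

theorem realize_satSentence (A : Struc.{u, v, w} L) (c : Clause L K) :
    A ⊨ c.satSentence ↔
      ∀ b, SeparationClass.Holds A c.γ b → ∃ S, c.ψ.Holds A S b := by
  refine FirstOrder.Language.BoundedFormula.realize_alls.trans (forall_congr' fun b => ?_)
  rw [← QF.holds_sat]
  exact Iff.rfl

theorem holds_conj_γ (A : Struc.{u, v, w} L) (c d : Clause L K) (b : Fin (c.arity + d.arity) → A) :
    SeparationClass.Holds A (c.conj d).γ b ↔
      SeparationClass.Holds A c.γ (b ∘ Fin.castAdd _) ∧
        SeparationClass.Holds A d.γ (b ∘ Fin.natAdd _) := by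
  refine (holds_andFml A _ _ b).trans ?_
  rw [holds_renameFml, holds_renameFml]

theorem holds_conj_ψ (A : Struc.{u, v, w} L) (c d : Clause L K) (b : Fin (c.arity + d.arity) → A)
    (S : Fin K → Set A) :
    (c.conj d).ψ.Holds A S b ↔
      c.ψ.Holds A S (b ∘ Fin.castAdd _) ∧ d.ψ.Holds A S (b ∘ Fin.natAdd _) := by
  refine (QF.holds_and A S _ _ b).trans ?_
  rw [QF.holds_rename, QF.holds_rename]

/-- The sentences that approximate a separation rule. -/
def approx (c : Clause L K) (cs : List (Clause L K)) : L.Sentence := (cs.foldl conj c).satSentence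

/-- The clause `c` is the accumulator of the fold. The hypothesis asks for predicates that also
satisfy the clauses not yet absorbed, which is what the induction passes on. -/
theorem realize_approx (A : Struc.{u, v, w} L) (cs : List (Clause L K)) : ∀ c : Clause L K,
    (∀ b, SeparationClass.Holds A c.γ b → ∃ S, c.ψ.Holds A S b ∧ ∀ d ∈ cs, d.Holds A S) →
      A ⊨ c.approx cs := by
  induction cs with
  | nil =>
    intro c h
    exact (realize_satSentence A c).2 fun b hb => (h b hb).imp fun S hS => hS.1
  | cons d cs ih =>
    intro c h
    refine ih (c.conj d) fun b hb => ?_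
    obtain ⟨hc, hd⟩ := (holds_conj_γ A c d b).1 hb
    obtain ⟨S, hS, hcs⟩ := h _ hc
    refine ⟨S, (holds_conj_ψ A c d b S).2 ⟨hS, hcs d (by simp) _ hd⟩, fun e he => hcs e (by simp [he])⟩

/-- Since `Clause.conj` keeps variables disjoint, each entry of the list is instantiated at its own
tuple. A clause may occur several times, so one approximation treats several instances of it at
once. -/
theorem exists_sets_of_approx (A : Struc.{u, v, w} L)
    (l : List (Σ c : Clause L K, Fin c.arity → A))
    (hl : ∀ p ∈ l, SeparationClass.Holds A p.1.γ p.2) : ∀ c : Clause L K,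
    A ⊨ c.approx (l.map Sigma.fst) → ∀ b, SeparationClass.Holds A c.γ b →
      ∃ S, c.ψ.Holds A S b ∧ ∀ p ∈ l, p.1.ψ.Holds A S p.2 := by
  induction l with
  | nil =>
    intro c h b hb
    obtain ⟨S, hS⟩ := (realize_satSentence A c).1 h b hb
    exact ⟨S, hS, by simp⟩
  | cons p l ih =>
    obtain ⟨d, e⟩ := p
    intro c h b hb
    have hl1 : (Fin.append b e) ∘ Fin.castAdd d.arity = b := funext fun i => by simp
    have hl2 : (Fin.append b e) ∘ Fin.natAdd c.arity = e := funext fun i => by simp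
    obtain ⟨S, hS, hS'⟩ := ih (fun p hp => hl p (by simp [hp])) (c.conj d) h (Fin.append b e)
      ((holds_conj_γ A c d _).2 ⟨by rwa [hl1], by rw [hl2]; exact hl ⟨d, e⟩ (by simp)⟩)
    obtain ⟨h1, h2⟩ := (holds_conj_ψ A c d _ S).1 hS
    rw [hl1] at h1
    rw [hl2] at h2
    refine ⟨S, h1, fun p hp => ?_⟩
    rcases List.mem_cons.1 hp with rfl | hp
    · exact h2
    · exact hS' p hp

end Clause

theorem isClopen_setOf_const {X : Type*} [TopologicalSpace X] (p : Prop) :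
    IsClopen {_x : X | p} := by
  by_cases h : p
  · simpa [h] using isClopen_univ
  · simpa [h] using isClopen_empty

/-- An atom `C_k(t)` reads one coordinate of the product, and clopen sets are closed under Boolean
operations. -/
theorem QF.isClopen_holds {n : ℕ} (A : Struc.{u, v, w} L) (a : Fin n → A) (θ : QF L K n) :
    IsClopen {f : Fin K → A → Bool | θ.Holds A (fun k => {x | f k x = true}) a} := by
  induction θ with
  | falsum => exact isClopen_empty
  | equal s t => exact isClopen_setOf_const _
  | rel R ts => exact isClopen_setOf_const _
  | mem k t =>
    exact (isClopen_discrete {true}).preimage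
      (f := fun f : Fin K → A → Bool => f k (value A t a)) (by fun_prop)
  | imp φ ψ hφ hψ =>
    have := hφ.compl.union hψ
    convert this using 1
    ext f
    exact imp_iff_not_or

/-- A separation rule is equivalent to the set of its finite approximations. -/
theorem holds_rule_iff (A : Struc.{u, v, w} L) {N : ℕ} (hK : 1 ≤ K) (μ : Fml L N) (η : QF L K N)
    (τ : Set (Clause L K)) :
    (SepRule.rule N K hK μ η τ).Holds A ↔
      ∀ cs : List (Clause L K), (∀ c ∈ cs, c ∈ τ) → A ⊨ Clause.approx ⟨N, μ, η⟩ cs := by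
  constructor
  · intro h cs hcs
    exact Clause.realize_approx A cs _ fun b hb =>
      (h b hb).imp fun S hS => ⟨hS.1, fun d hd => hS.2 d (hcs d hd)⟩
  · intro h a ha
    -- `I` consists of the clause instances with true premiss; in `Option I` the extra point `none`
    -- stands for the condition `η`.
    let I := {p : Σ c : Clause L K, Fin c.arity → A // p.1 ∈ τ ∧ Holds A p.1.γ p.2}
    let F : Option I → Set (Fin K → A → Bool) := fun o =>
      o.elim {f | η.Holds A (fun k => {x | f k x = true}) a}
        fun i => {f | i.1.1.ψ.Holds A (fun k => {x | f k x = true}) i.1.2}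
    have hF : ∀ o, IsClosed (F o) := fun o =>
      match o with
      | none => (η.isClopen_holds A a).isClosed
      | some i => (i.1.1.ψ.isClopen_holds A i.1.2).isClosed
    have hne : (⋂ o, F o).Nonempty := by
      by_contra hne
      -- The product of copies of `Bool` is compact by Tychonoff's theorem, so an empty intersection
      -- would already be empty over a finite `t`.
      obtain ⟨t, ht⟩ := isCompact_univ.elim_finite_subfamily_closed F hF
        (by rw [Set.univ_inter]; exact Set.not_nonempty_iff_eq_empty.1 hne)
      rw [Set.univ_inter] at ht
      -- Dropping `none` loses nothing: the initial clause `⟨N, μ, η⟩` of every approximation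
      -- carries `η`.
      let l : List I := t.toList.filterMap id
      obtain ⟨S, hS, hS'⟩ := Clause.exists_sets_of_approx A (l.map Subtype.val)
        (by
          intro p hp
          obtain ⟨i, -, rfl⟩ := List.mem_map.1 hp
          exact i.2.2) ⟨N, μ, η⟩
        (h _ (by
          intro c hc
          obtain ⟨p, hp, rfl⟩ := List.mem_map.1 hc
          obtain ⟨i, -, rfl⟩ := List.mem_map.1 hp
          exact i.2.1)) a ha
      classical
      have hmem : (fun k x => decide (x ∈ S k)) ∈ ⋂ o ∈ t, F o := by
        refine Set.mem_iInter₂.2 fun o ho => ?_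
        match o, ho with
        | none, _ =>
          change η.Holds A _ a
          simpa using hS
        | some i, ho =>
          change i.1.1.ψ.Holds A _ i.1.2
          have := hS' i.1 (List.mem_map.2 ⟨i, by simpa [l] using ho, rfl⟩)
          simpa using this
      rw [ht] at hmem
      exact hmem
    obtain ⟨f, hf⟩ := hne
    have hf := Set.mem_iInter.1 hf
    exact ⟨fun k => {x | f k x = true}, hf none, fun c hc b hb => hf (some ⟨⟨c, b⟩, hc, hb⟩)⟩

/-- The first-order sentences that together are equivalent to a separation rule. -/
def SepRule.approximations : SepRule L → L.Theory
  | .sentence φ => {φ}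
  | .rule N _ _ μ η τ => {χ | ∃ cs, (∀ c ∈ cs, c ∈ τ) ∧ Clause.approx ⟨N, μ, η⟩ cs = χ}

theorem SepRule.holds_iff (A : Struc.{u, v, w} L) (σ : SepRule L) :
    σ.Holds A ↔ A ⊨ σ.approximations := by
  rw [FirstOrder.Language.Theory.model_iff]
  cases σ with
  | sentence φ => simp [SepRule.Holds, SepRule.approximations]
  | rule N K hK μ η τ =>
    rw [holds_rule_iff]
    constructor
    · rintro h _ ⟨cs, hcs, rfl⟩
      exact h cs hcs
    · exact fun h cs hcs => h _ ⟨cs, hcs, rfl⟩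

end Approximation

/-! ### Inclusions without computability -/

section Inclusions

variable {L : FirstOrder.Language.{u, v}} {𝒜 : Set (Struc.{u, v, w} L)}

theorem definedBy_eq_models (Sch : Set (SepRule L)) :
    definedBy 𝒜 Sch = {A | A ∈ 𝒜 ∧ A ⊨ ⋃ σ ∈ Sch, σ.approximations} := by
  ext A
  refine and_congr_right fun _ => ?_
  rw [FirstOrder.Language.Theory.model_iff]
  simp only [SepRule.holds_iff, FirstOrder.Language.Theory.model_iff, Set.mem_iUnion]
  exact ⟨fun h φ ⟨σ, hσ, hφ⟩ => h σ hσ φ hφ, fun h σ hσ φ hφ => h φ ⟨σ, hσ, hφ⟩⟩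

theorem definedBy_image_sentence (T : L.Theory) :
    definedBy 𝒜 (SepRule.sentence '' T) = {A | A ∈ 𝒜 ∧ A ⊨ T} := by
  ext A
  refine and_congr_right fun _ => ?_
  rw [FirstOrder.Language.Theory.model_iff]
  simp [SepRule.Holds]

theorem models_mem_E (h𝒜 : IsElementary 𝒜) (T : L.Theory) : {A | A ∈ 𝒜 ∧ A ⊨ T} ∈ E 𝒜 := by
  obtain ⟨T₀, rfl⟩ := h𝒜
  exact ⟨fun A hA => hA.1, T₀ ∪ T, by ext A; simp [FirstOrder.Language.Theory.model_union_iff]⟩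

theorem FE_subset_FS : FE 𝒜 ⊆ FS 𝒜 := by
  rintro _ ⟨T, hT, rfl⟩
  refine ⟨_, ⟨hT.image SepRule.sentence, ?_⟩, (definedBy_image_sentence T).symm⟩
  rintro _ ⟨φ, -, rfl⟩
  trivial

theorem FS_subset_S : FS 𝒜 ⊆ S 𝒜 := fun _ ⟨Sch, _, h⟩ => ⟨Sch, h⟩

theorem FE_subset_E (h𝒜 : IsElementary 𝒜) : FE 𝒜 ⊆ E 𝒜 := by
  rintro _ ⟨T, -, rfl⟩
  exact models_mem_E h𝒜 T

theorem S_eq_E (h𝒜 : IsElementary 𝒜) : S 𝒜 = E 𝒜 := by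
  ext ℬ
  constructor
  · rintro ⟨Sch, rfl⟩
    rw [definedBy_eq_models]
    exact models_mem_E h𝒜 _
  · rintro ⟨hℬ, T, rfl⟩
    refine ⟨SepRule.sentence '' T, ?_⟩
    rw [definedBy_image_sentence]
    ext A
    exact ⟨fun h => ⟨hℬ h, h⟩, fun h => h.2⟩

end Inclusions

/-! ### Syntactic operations as functions of Gödel numbers -/

section CodeFunctions

theorem lt_encode_list {l : List ℕ} {a : ℕ} (h : a ∈ l) : a < Encodable.encode l := by
  induction l with
  | nil => simp at h
  | cons b l ih =>
    rw [Encodable.encode_list_cons]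
    rcases List.mem_cons.1 h with rfl | h
    · exact Nat.lt_succ_of_le (Nat.left_le_pair _ _)
    · exact ((ih h).trans_le (Nat.right_le_pair _ _)).trans (Nat.lt_succ_self _)

/-- The codes of the arguments of the function or relation symbol in a code. -/
def argCodes (t : ℕ) : List ℕ := Denumerable.ofNat (List ℕ) (t / 2).unpair.2.unpair.2

theorem lt_of_mem_argCodes {t a : ℕ} (h : a ∈ argCodes t) : a < t := by
  have := lt_encode_list h
  rw [argCodes, Denumerable.encode_ofNat] at this
  have h1 := Nat.unpair_right_le (t / 2).unpair.2
  have h2 := Nat.unpair_right_le (t / 2)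
  omega

/-- The renaming that adds `d` to all variables except the first `c`. -/
def shiftVar (p : ℕ × ℕ) (i : ℕ) : ℕ := if i < p.1 then i else i + p.2

/-- The effect of `shiftVar` on the code of a term. -/
def termShift (p : ℕ × ℕ) (t : ℕ) : ℕ :=
  if t % 2 = 0 then 2 * shiftVar p (t / 2)
  else 2 * Nat.pair (t / 2).unpair.1 (Nat.pair (t / 2).unpair.2.unpair.1
    (Encodable.encode ((argCodes t).attach.map fun a => termShift p a.1))) + 1
termination_by t
decreasing_by exact lt_of_mem_argCodes a.2

/-- Recursion on the codes of formulas: `leaf` is used at the codes of atomic formulas, `imp` at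
those of implications, and `last` at those of quantified formulas or second-order atoms. -/
def codeFold {α σ : Type*} (leaf : α → ℕ → σ) (imp : α → σ → σ → σ) (last : α → ℕ → σ → σ)
    (a : α) (b : ℕ) : σ :=
  if h : b = 0 then leaf a 0
  -- After subtracting 1, the residues 0, 1, 2, 3 mark equalities, relational atoms, implications,
  -- and quantified formulas or second-order atoms.
  else if (b - 1) % 4 = 2 then
    imp a (codeFold leaf imp last a ((b - 1) / 4).unpair.1)
      (codeFold leaf imp last a ((b - 1) / 4).unpair.2)
  else if (b - 1) % 4 = 3 then last a ((b - 1) / 4) (codeFold leaf imp last a ((b - 1) / 4))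
  else leaf a b
termination_by b
decreasing_by
  · have := Nat.unpair_left_le ((b - 1) / 4)
    omega
  · have := Nat.unpair_right_le ((b - 1) / 4)
    omega
  · omega

section codeFold

variable {α σ : Type*} (leaf : α → ℕ → σ) (imp : α → σ → σ → σ) (last : α → ℕ → σ → σ) (a : α)

theorem codeFold_zero : codeFold leaf imp last a 0 = leaf a 0 := by
  rw [codeFold, dif_pos rfl]

theorem codeFold_one (x : ℕ) : codeFold leaf imp last a (4 * x + 1) = leaf a (4 * x + 1) := by
  rw [codeFold, dif_neg (by omega), if_neg (by omega), if_neg (by omega)]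

theorem codeFold_two (x : ℕ) : codeFold leaf imp last a (4 * x + 2) = leaf a (4 * x + 2) := by
  rw [codeFold, dif_neg (by omega), if_neg (by omega), if_neg (by omega)]

theorem codeFold_imp (x y : ℕ) : codeFold leaf imp last a (4 * Nat.pair x y + 3) =
    imp a (codeFold leaf imp last a x) (codeFold leaf imp last a y) := by
  rw [codeFold, dif_neg (by omega), if_pos (by omega)]
  have : (4 * Nat.pair x y + 3 - 1) / 4 = Nat.pair x y := by omega
  rw [this, Nat.unpair_pair]

theorem codeFold_last (x : ℕ) : codeFold leaf imp last a (4 * x + 4) =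
    last a x (codeFold leaf imp last a x) := by
  rw [codeFold, dif_neg (by omega), if_neg (by omega), if_pos (by omega)]
  have : (4 * x + 4 - 1) / 4 = x := by omega
  rw [this]

end codeFold

/-- The effect of `shiftVar` on the code of an atomic formula. -/
def leafShift (p : ℕ × ℕ) (b : ℕ) : ℕ :=
  if b % 4 = 1 then
    4 * Nat.pair (termShift p (b / 4).unpair.1) (termShift p (b / 4).unpair.2) + 1
  -- The code `2 * (b / 4) + 1` has the shape of that of a compound term, so `termShift` renames the
  -- arguments of the relation; halving removes the disguise.
  else if b % 4 = 2 then 4 * (termShift p (2 * (b / 4) + 1) / 2) + 2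
  else 0

/-- The code of an implication. -/
def impCode (x y : ℕ) : ℕ := 4 * Nat.pair x y + 3

/-- The code of a conjunction. -/
def andCode (x y : ℕ) : ℕ := impCode (impCode x (impCode y 0)) 0

/-- The effect of `shiftVar` on the code of a first-order formula. -/
def fmlShift : ℕ × ℕ → ℕ → ℕ :=
  codeFold leafShift (fun _ => impCode) fun _ _ r => 4 * r + 4

/-- The effect of `shiftVar` on the code of a quantifier-free formula. -/
def qfShift : ℕ × ℕ → ℕ → ℕ :=
  codeFold leafShift (fun _ => impCode) fun p x _ =>
    4 * Nat.pair x.unpair.1 (termShift p x.unpair.2) + 4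

/-- The codes of the second-order atoms of a formula, from its code. -/
def atomCodes : ℕ → List ℕ :=
  codeFold (fun _ _ => []) (fun _ l l' => l ++ l') (fun _ x _ => [x]) ()

/-- The code of a disjunction, from the codes of its members. -/
def disjCode (l : List ℕ) : ℕ := l.foldr (fun x y => impCode (impCode x 0) y) 0

/-- The effect of `QF.subst` on codes. -/
def substCode : List ℕ → ℕ → ℕ :=
  codeFold (fun _ b => b) (fun _ => impCode) fun P x _ =>
    disjCode ((P.filter fun p => p.unpair.1 = x.unpair.1).map fun p =>
      4 * Nat.pair x.unpair.2 p.unpair.2 + 1)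

/-- The effect of `QF.sat` on codes. -/
def satCode (θ : ℕ) : ℕ := disjCode ((atomCodes θ).sublists'.map fun P => substCode P θ)

/-- The effect of `Clause.conj` on codes. -/
def conjCode (c d : ℕ) : ℕ :=
  Nat.pair (c.unpair.1 + d.unpair.1) (Nat.pair
    (andCode (fmlShift (c.unpair.1, d.unpair.1) c.unpair.2.unpair.1)
      (fmlShift (0, c.unpair.1) d.unpair.2.unpair.1))
    (andCode (qfShift (c.unpair.1, d.unpair.1) c.unpair.2.unpair.2)
      (qfShift (0, c.unpair.1) d.unpair.2.unpair.2)))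

/-- The effect of `Clause.satSentence` on codes. -/
def satSentenceCode (c : ℕ) : ℕ :=
  (fun x => 4 * x + 4)^[c.unpair.1] (impCode c.unpair.2.unpair.1 (satCode c.unpair.2.unpair.2))

/-- The effect of `Clause.approx` on codes. -/
def approxCode (c : ℕ) (cs : List ℕ) : ℕ := satSentenceCode (cs.foldl conjCode c)

end CodeFunctions

/-! ### Primitive recursiveness of the code functions -/

section Primrec

open Primrec

theorem primrec_argCodes : Primrec argCodes :=
  (Primrec.ofNat (List ℕ)).comp <| snd.comp <| unpair.comp <| snd.comp <| unpair.comp <|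
    nat_div.comp .id (const 2)

theorem primrec_shiftVar : Primrec₂ shiftVar :=
  Primrec.ite (nat_lt.comp snd (fst.comp fst)) snd (nat_add.comp snd (snd.comp fst))

theorem primrec_termShift : Primrec₂ termShift := by
  have ht : Primrec fun q : (ℕ × ℕ) × ℕ × List ℕ => q.2.1 := fst.comp snd
  have ht2 : Primrec fun q : (ℕ × ℕ) × ℕ × List ℕ => q.2.1 / 2 := nat_div.comp ht (const 2)
  -- Course-of-values recursion: the values at the smaller arguments `argCodes t` arrive as the list
  -- `q.2`.
  refine nat_omega_rec termShift (m := fun _ t => t) (l := fun _ t => argCodes t)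
    (g := fun p q => some (if q.1 % 2 = 0 then 2 * shiftVar p (q.1 / 2)
      else 2 * Nat.pair (q.1 / 2).unpair.1 (Nat.pair (q.1 / 2).unpair.2.unpair.1
        (Encodable.encode q.2)) + 1)) snd (primrec_argCodes.comp snd) ?_
    (fun _ t a ha => lt_of_mem_argCodes ha) (fun p t => ?_)
  · refine option_some.comp (Primrec.ite (Primrec.eq.comp (nat_mod.comp ht (const 2)) (const 0))
      (nat_mul.comp (const 2) (primrec_shiftVar.comp fst ht2))
      (succ.comp (nat_mul.comp (const 2) ?_)))
    exact Primrec₂.natPair.comp (fst.comp (unpair.comp ht2)) (Primrec₂.natPair.comp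
      (fst.comp (unpair.comp (snd.comp (unpair.comp ht2)))) (Primrec.encode.comp (snd.comp snd)))
  · conv_rhs => rw [termShift]
    simp only [List.map_attach_eq_pmap, List.pmap_eq_map]

theorem primrec_codeFold {α σ : Type*} [Primcodable α] [Primcodable σ] {leaf : α → ℕ → σ}
    {imp : α → σ → σ → σ} {last : α → ℕ → σ → σ} (hleaf : Primrec₂ leaf)
    (himp : Primrec fun q : α × σ × σ => imp q.1 q.2.1 q.2.2)
    (hlast : Primrec fun q : α × ℕ × σ => last q.1 q.2.1 q.2.2) :
    Primrec₂ (codeFold leaf imp last) := by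
  have ha : Primrec fun q : α × ℕ × List σ => q.1 := fst
  have hb : Primrec fun q : α × ℕ × List σ => q.2.1 := fst.comp snd
  have hp : Primrec fun q : α × ℕ × List σ => q.2.1 - 1 := nat_sub.comp hb (const 1)
  have hx : Primrec fun q : α × ℕ × List σ => (q.2.1 - 1) / 4 := nat_div.comp hp (const 4)
  have hm : Primrec fun q : α × ℕ × List σ => (q.2.1 - 1) % 4 := nat_mod.comp hp (const 4)
  -- The default is a filler. All three possible recursive calls are made whenever `b ≠ 0`,
  -- whichever branch applies, and for `b = 0` no recursive value is used.
  have hget : ∀ i : ℕ, Primrec fun q : α × ℕ × List σ => (q.2.2[i]?).getD (leaf q.1 0) := fun i =>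
    option_getD.comp (list_getElem?.comp (snd.comp snd) (const i)) (hleaf.comp ha (const 0))
  refine nat_omega_rec (codeFold leaf imp last) (m := fun _ b => b)
    (l := fun _ b => if b = 0 then [] else
      [((b - 1) / 4).unpair.1, ((b - 1) / 4).unpair.2, (b - 1) / 4])
    (g := fun a q => some (if q.1 = 0 then leaf a 0
      else if (q.1 - 1) % 4 = 2 then
        imp a ((q.2[0]?).getD (leaf a 0)) ((q.2[1]?).getD (leaf a 0))
      else if (q.1 - 1) % 4 = 3 then last a ((q.1 - 1) / 4) ((q.2[2]?).getD (leaf a 0))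
      else leaf a q.1)) snd ?_ ?_ ?_ ?_
  · have hx : Primrec fun q : α × ℕ => (q.2 - 1) / 4 :=
      nat_div.comp (nat_sub.comp snd (const 1)) (const 4)
    exact Primrec.ite (Primrec.eq.comp snd (const 0)) (const []) <|
      list_cons.comp (fst.comp (unpair.comp hx)) <|
      list_cons.comp (snd.comp (unpair.comp hx)) <| list_cons.comp hx (const [])
  · exact option_some.comp <|
      Primrec.ite (Primrec.eq.comp hb (const 0)) (hleaf.comp ha (const 0)) <|
      Primrec.ite (Primrec.eq.comp hm (const 2))
        (himp.comp (Primrec.pair ha (Primrec.pair (hget 0) (hget 1)))) <|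
      Primrec.ite (Primrec.eq.comp hm (const 3))
        (hlast.comp (Primrec.pair ha (Primrec.pair hx (hget 2)))) (hleaf.comp ha hb)
  · intro a b b' hb'
    have h1 := Nat.unpair_left_le ((b - 1) / 4)
    have h2 := Nat.unpair_right_le ((b - 1) / 4)
    by_cases h : b = 0
    · simp [h] at hb'
    · simp only [if_neg h, List.mem_cons, List.not_mem_nil, or_false] at hb'
      omega
  · intro a b
    conv_rhs => rw [codeFold]
    by_cases h : b = 0 <;> simp [h]

theorem primrec_impCode : Primrec₂ impCode :=
  nat_add.comp (nat_mul.comp (const 4) Primrec₂.natPair) (const 3)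

theorem primrec_andCode : Primrec₂ andCode :=
  primrec_impCode.comp
    (primrec_impCode.comp fst (primrec_impCode.comp snd (const 0))) (const 0)

theorem primrec_leafShift : Primrec₂ leafShift := by
  have hm : Primrec fun q : (ℕ × ℕ) × ℕ => q.2 % 4 := nat_mod.comp snd (const 4)
  have hx : Primrec fun q : (ℕ × ℕ) × ℕ => q.2 / 4 := nat_div.comp snd (const 4)
  have hs := primrec_termShift
  exact Primrec.ite (Primrec.eq.comp hm (const 1))
    (nat_add.comp (nat_mul.comp (const 4) (Primrec₂.natPair.comp
      (hs.comp fst (fst.comp (unpair.comp hx))) (hs.comp fst (snd.comp (unpair.comp hx)))))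
      (const 1)) <|
    Primrec.ite (Primrec.eq.comp hm (const 2))
      (nat_add.comp (nat_mul.comp (const 4) (nat_div.comp
        (hs.comp fst (nat_add.comp (nat_mul.comp (const 2) hx) (const 1))) (const 2))) (const 2))
      (const 0)

theorem primrec_fmlShift : Primrec₂ fmlShift :=
  primrec_codeFold primrec_leafShift (primrec_impCode.comp (fst.comp snd) (snd.comp snd))
    (nat_add.comp (nat_mul.comp (const 4) (snd.comp snd)) (const 4))

theorem primrec_qfShift : Primrec₂ qfShift := by
  have hx : Primrec fun q : (ℕ × ℕ) × ℕ × ℕ => q.2.1.unpair := unpair.comp (fst.comp snd)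
  exact primrec_codeFold primrec_leafShift (primrec_impCode.comp (fst.comp snd) (snd.comp snd))
    (nat_add.comp (nat_mul.comp (const 4) (Primrec₂.natPair.comp (fst.comp hx)
      (primrec_termShift.comp fst (snd.comp hx)))) (const 4))

theorem primrec_atomCodes : Primrec atomCodes :=
  (primrec_codeFold (α := Unit) (const []).to₂ (list_append.comp (fst.comp snd) (snd.comp snd))
    (list_cons.comp (fst.comp snd) (const []))).comp (const ()) .id

theorem primrec_disjCode : Primrec disjCode :=
  list_foldr .id (const 0) (primrec_impCode.comp
    (primrec_impCode.comp (fst.comp snd) (const 0)) (snd.comp snd)).to₂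

theorem primrec_substCode : Primrec₂ substCode := by
  refine primrec_codeFold snd (primrec_impCode.comp (fst.comp snd) (snd.comp snd)) (primrec_disjCode.comp ?_)
  have hP : Primrec fun q : List ℕ × ℕ × ℕ => q.1 := fst
  have hx : Primrec fun q : List ℕ × ℕ × ℕ => q.2.1.unpair := unpair.comp (fst.comp snd)
  have hR : PrimrecRel fun (p k : ℕ) => p.unpair.1 = k :=
    Primrec.eq.comp (fst.comp (unpair.comp fst)) snd
  exact list_map (hR.listFilter.comp hP (fst.comp hx))
    (nat_add.comp (nat_mul.comp (const 4) (Primrec₂.natPair.comp (snd.comp (hx.comp fst))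
      (snd.comp (unpair.comp snd)))) (const 1)).to₂

theorem primrec_sublists' : Primrec (List.sublists' : List ℕ → List (List ℕ)) := by
  refine (list_foldr (f := fun l : List ℕ => l) (g := fun _ => [List.nil])
    (h := fun _ q => q.2 ++ q.2.map (q.1 :: ·)) .id (const _) ?_).of_eq fun l => ?_
  · exact list_append.comp (snd.comp snd)
      (list_map (snd.comp snd) (list_cons.comp (fst.comp (snd.comp fst)) snd).to₂)
  · induction l with
    | nil => rfl
    | cons a l ih => rw [List.sublists'_cons, ← ih]; rfl

theorem primrec_satCode : Primrec satCode :=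
  primrec_disjCode.comp (list_map (primrec_sublists'.comp primrec_atomCodes)
    (primrec_substCode.comp snd fst).to₂)

theorem primrec_conjCode : Primrec₂ conjCode := by
  have c1 : Primrec fun q : ℕ × ℕ => q.1.unpair.1 := fst.comp (unpair.comp fst)
  have d1 : Primrec fun q : ℕ × ℕ => q.2.unpair.1 := fst.comp (unpair.comp snd)
  have c2 : Primrec fun q : ℕ × ℕ => q.1.unpair.2.unpair := unpair.comp (snd.comp (unpair.comp fst))
  have d2 : Primrec fun q : ℕ × ℕ => q.2.unpair.2.unpair := unpair.comp (snd.comp (unpair.comp snd))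
  exact Primrec₂.natPair.comp (nat_add.comp c1 d1) <| Primrec₂.natPair.comp
    (primrec_andCode.comp (primrec_fmlShift.comp (Primrec.pair c1 d1) (fst.comp c2))
      (primrec_fmlShift.comp (Primrec.pair (const 0) c1) (fst.comp d2)))
    (primrec_andCode.comp (primrec_qfShift.comp (Primrec.pair c1 d1) (snd.comp c2))
      (primrec_qfShift.comp (Primrec.pair (const 0) c1) (snd.comp d2)))

theorem primrec_satSentenceCode : Primrec satSentenceCode := by
  have c2 : Primrec fun c : ℕ => c.unpair.2.unpair := unpair.comp (snd.comp unpair)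
  exact nat_iterate (fst.comp unpair)
    (primrec_impCode.comp (fst.comp c2) (primrec_satCode.comp (snd.comp c2)))
    (nat_add.comp (nat_mul.comp (const 4) snd) (const 4)).to₂

theorem primrec_approxCode : Primrec₂ approxCode := by
  have hfold : ∀ {f : ℕ → ℕ → ℕ}, Primrec₂ f →
      Primrec fun q : ℕ × List ℕ => q.2.foldl f q.1 := fun hf =>
    list_foldl snd fst (hf.comp (fst.comp snd) (snd.comp snd)).to₂
  exact primrec_satSentenceCode.comp (hfold primrec_conjCode)

end Primrec

/-! ### Correctness of the code functions; injectivity of Gödel numbers -/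

section Codes

variable {L : FirstOrder.Language.{u, v}} [EffectiveSignature L] {K : ℕ}

theorem termCode_rename {n n' : ℕ} {p : ℕ × ℕ} {ρ : Fin n → Fin n'}
    (hρ : ∀ i, (ρ i : ℕ) = shiftVar p i) (t : Trm L n) :
    termCode (renameTerm ρ t) = termShift p (termCode t) := by
  induction t with
  | var x =>
    cases x with
    | inl e => exact e.elim
    | inr i =>
      rw [termShift]
      simp [renameTerm, FirstOrder.Language.Term.relabel, termCode, hρ]
  | func f ts ih =>
    have harg : argCodes (termCode (FirstOrder.Language.Term.func f ts : Trm L n)) =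
        List.ofFn fun i => termCode (ts i) := by
      rw [argCodes, termCode, Nat.mul_add_div (by norm_num)]
      simp [Denumerable.ofNat_encode]
    rw [termShift, List.map_attach_eq_pmap, List.pmap_eq_map, harg]
    have h2 : ∀ x : ℕ, (2 * x + 1) / 2 = x := fun x => by omega
    rw [if_neg (by rw [termCode]; omega), renameTerm, FirstOrder.Language.Term.relabel, termCode,
      termCode, h2]
    simp only [Nat.unpair_pair, List.map_ofFn, Function.comp_def, ← ih]
    rfl

theorem relAtomCode_rename {n n' : ℕ} {p : ℕ × ℕ} {ρ : Fin n → Fin n'}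
    (hρ : ∀ i, (ρ i : ℕ) = shiftVar p i) {l : ℕ} (R : L.Relations l) (ts : Fin l → Trm L n) :
    relAtomCode R (fun i => renameTerm ρ (ts i)) = termShift p (2 * relAtomCode R ts + 1) / 2 := by
  have harg : argCodes (2 * relAtomCode R ts + 1) = List.ofFn fun i => termCode (ts i) := by
    rw [argCodes, relAtomCode, Nat.mul_add_div (by norm_num)]
    simp [Denumerable.ofNat_encode]
  rw [termShift, List.map_attach_eq_pmap, List.pmap_eq_map, harg, if_neg (by omega)]
  have h2 : ∀ x : ℕ, (2 * x + 1) / 2 = x := fun x => by omega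
  rw [h2, h2, relAtomCode, relAtomCode]
  simp only [Nat.unpair_pair, List.map_ofFn, Function.comp_def, termCode_rename hρ]

theorem leafShift_equal {n n' : ℕ} {p : ℕ × ℕ} {ρ : Fin n → Fin n'}
    (hρ : ∀ i, (ρ i : ℕ) = shiftVar p i) (s t : Trm L n) :
    leafShift p (4 * Nat.pair (termCode s) (termCode t) + 1) =
      4 * Nat.pair (termCode (renameTerm ρ s)) (termCode (renameTerm ρ t)) + 1 := by
  have h : ∀ x : ℕ, (4 * x + 1) / 4 = x := fun x => by omega
  rw [leafShift, if_pos (by omega), h, Nat.unpair_pair, termCode_rename hρ, termCode_rename hρ]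

theorem leafShift_rel {n n' : ℕ} {p : ℕ × ℕ} {ρ : Fin n → Fin n'}
    (hρ : ∀ i, (ρ i : ℕ) = shiftVar p i) {l : ℕ} (R : L.Relations l) (ts : Fin l → Trm L n) :
    leafShift p (4 * relAtomCode R ts + 2) =
      4 * relAtomCode R (fun i => renameTerm ρ (ts i)) + 2 := by
  have h : ∀ x : ℕ, (4 * x + 2) / 4 = x := fun x => by omega
  rw [leafShift, if_neg (by omega), if_pos (by omega), h, relAtomCode_rename hρ]

/-- A quantifier over a formula in `n` variables binds the variable with index `n`, so bound
variables move too: the new one goes from `n` to `n' = n + p.2`. As `p.1 ≤ n`, this is again the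
action of `shiftVar p`, and the same `p` works under quantifiers. -/
theorem fmlCode_rename {p : ℕ × ℕ} {n : ℕ} (φ : Fml L n) :
    ∀ {n' : ℕ} {ρ : Fin n → Fin n'}, (∀ i, (ρ i : ℕ) = shiftVar p i) → n' = n + p.2 → p.1 ≤ n →
      fmlCode (renameFml ρ φ) = fmlShift p (fmlCode φ) := by
  induction φ with
  | falsum =>
    intro n' ρ _ _ _
    refine Eq.trans ?_ (codeFold_zero _ _ _ _).symm
    rfl
  | equal s t =>
    intro n' ρ hρ _ _
    exact (leafShift_equal hρ s t).symm.trans (codeFold_one _ _ _ _ _).symm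
  | rel R ts =>
    intro n' ρ hρ _ _
    exact (leafShift_rel hρ R ts).symm.trans (codeFold_two _ _ _ _ _).symm
  | imp φ ψ hφ hψ =>
    intro n' ρ hρ hn hp
    refine Eq.trans ?_ (codeFold_imp _ _ _ _ _ _).symm
    exact congrArg₂ impCode (hφ hρ hn hp) (hψ hρ hn hp)
  | @all n φ h =>
    intro n' ρ hρ hn hp
    refine Eq.trans ?_ (codeFold_last _ _ _ _ _).symm
    refine congrArg (fun x => 4 * x + 4) (h (fun i => ?_) (by omega) (by omega))
    refine Fin.lastCases ?_ (fun i => ?_) i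
    · simp [extendRenaming, shiftVar, hn, hp]
    · simp [extendRenaming, hρ]

theorem QF.code_rename {n n' : ℕ} {p : ℕ × ℕ} {ρ : Fin n → Fin n'}
    (hρ : ∀ i, (ρ i : ℕ) = shiftVar p i) (θ : QF L K n) :
    (θ.rename ρ).code = qfShift p θ.code := by
  induction θ with
  | falsum => refine Eq.trans ?_ (codeFold_zero _ _ _ _).symm; rfl
  | equal s t => exact (leafShift_equal hρ s t).symm.trans (codeFold_one _ _ _ _ _).symm
  | rel R ts => exact (leafShift_rel hρ R ts).symm.trans (codeFold_two _ _ _ _ _).symm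
  | imp φ ψ hφ hψ =>
    exact (congrArg₂ impCode hφ hψ).trans (codeFold_imp _ _ _ _ _ _).symm
  | mem k t =>
    refine Eq.trans ?_ (codeFold_last _ _ _ _ _).symm
    simp [QF.rename, QF.code, termCode_rename hρ]

theorem fmlCode_disj {n : ℕ} (l : List (Fml L n)) : fmlCode (disj l) = disjCode (l.map fmlCode) := by
  induction l with
  | nil => rfl
  | cons φ l ih => exact congrArg (impCode (impCode (fmlCode φ) 0)) ih

/-- The code of a second-order atom. -/
def atomCode {n : ℕ} (p : Fin K × Trm L n) : ℕ := Nat.pair p.1 (termCode p.2)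

theorem fmlCode_memFml {n : ℕ} (P : List (Fin K × Trm L n)) (k : Fin K) (t : Trm L n) :
    fmlCode (memFml P k t) =
      disjCode (((P.map atomCode).filter fun p => p.unpair.1 = (k : ℕ)).map fun p =>
        4 * Nat.pair (termCode t) p.unpair.2 + 1) := by
  rw [memFml, fmlCode_disj, List.filter_map, List.map_map, List.map_map]
  congr 1
  have : (fun p : Fin K × Trm L n => decide (p.1 = k)) =
      (fun p : ℕ => decide (p.unpair.1 = (k : ℕ))) ∘ atomCode := by
    funext p
    simp [atomCode, Fin.ext_iff]
  rw [this]
  refine List.map_congr_left fun p _ => ?_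
  simp [atomCode, fmlCode]

theorem QF.fmlCode_subst {n : ℕ} (P : List (Fin K × Trm L n)) (θ : QF L K n) :
    fmlCode (θ.subst P) = substCode (P.map atomCode) θ.code := by
  induction θ with
  | falsum => refine Eq.trans ?_ (codeFold_zero _ _ _ _).symm; rfl
  | equal s t => refine Eq.trans ?_ (codeFold_one _ _ _ _ _).symm; rfl
  | rel R ts => refine Eq.trans ?_ (codeFold_two _ _ _ _ _).symm; rfl
  | imp φ ψ hφ hψ => exact (congrArg₂ impCode hφ hψ).trans (codeFold_imp _ _ _ _ _ _).symm
  | mem k t =>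
    refine (fmlCode_memFml P k t).trans (Eq.trans ?_ (codeFold_last _ _ _ _ _).symm)
    simp only [Nat.unpair_pair]

theorem QF.atomCodes_code {n : ℕ} (θ : QF L K n) : atomCodes θ.code = θ.atoms.map atomCode := by
  induction θ with
  | falsum => exact codeFold_zero _ _ _ _
  | equal s t => exact codeFold_one _ _ _ _ _
  | rel R ts => exact codeFold_two _ _ _ _ _
  | imp φ ψ hφ hψ =>
    refine (codeFold_imp _ _ _ _ _ _).trans ?_
    rw [QF.atoms, List.map_append, ← hφ, ← hψ]
    rfl
  | mem k t => exact codeFold_last _ _ _ _ _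

theorem QF.fmlCode_sat {n : ℕ} (θ : QF L K n) : fmlCode θ.sat = satCode θ.code := by
  rw [QF.sat, fmlCode_disj, satCode, QF.atomCodes_code, List.sublists'_map, List.map_map,
    List.map_map]
  exact congrArg disjCode (List.map_congr_left fun P _ => θ.fmlCode_subst P)

theorem fmlCode_alls {n : ℕ} (φ : Fml L n) :
    fmlCode φ.alls = (fun x => 4 * x + 4)^[n] (fmlCode φ) := by
  induction n with
  | zero => rfl
  | succ n ih => exact ih φ.all

theorem Clause.code_conj (c d : Clause L K) : (c.conj d).code = conjCode c.code d.code := by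
  -- `Fin.castAdd` fixes every free variable of `c`, but the shift by `d.arity` is still needed for
  -- the bound ones.
  have h1 : ∀ i : Fin c.arity,
      (Fin.castAdd d.arity i : ℕ) = shiftVar (c.arity, d.arity) i := fun i => by
    simp [shiftVar]
  have h2 : ∀ i : Fin d.arity, (Fin.natAdd c.arity i : ℕ) = shiftVar (0, c.arity) i := fun i => by
    simp [shiftVar, add_comm]
  simp only [conjCode, Clause.code, Nat.unpair_pair]
  rw [← fmlCode_rename c.γ h1 rfl le_rfl, ← fmlCode_rename d.γ h2 (add_comm _ _) (Nat.zero_le _),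
    ← QF.code_rename h1, ← QF.code_rename h2]
  rfl

theorem Clause.fmlCode_satSentence (c : Clause L K) :
    fmlCode (n := 0) c.satSentence = satSentenceCode c.code := by
  refine (fmlCode_alls _).trans ?_
  simp only [satSentenceCode, Clause.code, Nat.unpair_pair, ← QF.fmlCode_sat]
  rfl

theorem Clause.fmlCode_approx (cs : List (Clause L K)) : ∀ c : Clause L K,
    fmlCode (n := 0) (c.approx cs) = approxCode c.code (cs.map Clause.code) := by
  induction cs with
  | nil => exact fun c => c.fmlCode_satSentence
  | cons d cs ih =>
    intro c
    refine (ih (c.conj d)).trans ?_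
    rw [Clause.code_conj]
    rfl

theorem termCode_injective {n : ℕ} : Function.Injective (termCode : Trm L n → ℕ) := by
  intro s
  induction s with
  | var x =>
    intro t h
    cases x with
    | inl e => exact e.elim
    | inr i =>
      cases t with
      | var y =>
        cases y with
        | inl e => exact e.elim
        | inr j =>
          simp only [termCode] at h
          rw [Fin.ext (by omega : (i : ℕ) = j)]
      | func g ts => simp only [termCode] at h; omega
  | @func l f ss ih =>
    intro t h
    cases t with
    | var y =>
      cases y with
      | inl e => exact e.elim
      | inr j => simp only [termCode] at h; omega
    | @func l' g ts =>
      simp only [termCode] at h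
      have h := Nat.eq_of_mul_eq_mul_left (by norm_num) (Nat.succ.inj h)
      obtain ⟨rfl, h⟩ := Nat.pair_eq_pair.1 h
      obtain ⟨hf, hts⟩ := Nat.pair_eq_pair.1 h
      obtain rfl := EffectiveSignature.funCode_injective _ hf
      have h := List.ofFn_injective (Encodable.encode_injective hts)
      rw [funext fun i => ih i (congrFun h i)]

theorem fmlCode_injective {n : ℕ} : Function.Injective (fmlCode : Fml L n → ℕ) := by
  intro φ
  induction φ with
  | falsum => intro ψ h; cases ψ <;> simp only [fmlCode] at h <;> first | rfl | omega
  | equal s t =>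
    intro ψ h
    cases ψ <;> simp only [fmlCode] at h <;> try omega
    obtain ⟨h1, h2⟩ := Nat.pair_eq_pair.1 (Nat.eq_of_mul_eq_mul_left (by norm_num) (Nat.succ.inj h))
    rw [termCode_injective h1, termCode_injective h2]
  | rel R ts =>
    intro ψ h
    cases ψ <;> simp only [fmlCode] at h <;> try omega
    have h := Nat.eq_of_mul_eq_mul_left (by norm_num) (Nat.add_right_cancel h)
    obtain ⟨rfl, h⟩ := Nat.pair_eq_pair.1 h
    obtain ⟨hR, hts⟩ := Nat.pair_eq_pair.1 h
    obtain rfl := EffectiveSignature.relCode_injective _ hR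
    have h := List.ofFn_injective (Encodable.encode_injective hts)
    rw [funext fun i => termCode_injective (congrFun h i)]
  | imp φ₁ φ₂ h₁ h₂ =>
    intro ψ h
    cases ψ <;> simp only [fmlCode] at h <;> try omega
    obtain ⟨h1, h2⟩ := Nat.pair_eq_pair.1
      (Nat.eq_of_mul_eq_mul_left (by norm_num) (Nat.add_right_cancel h))
    rw [h₁ h1, h₂ h2]
  | all φ ih =>
    intro ψ h
    cases ψ <;> simp only [fmlCode] at h <;> try omega
    rw [ih (Nat.eq_of_mul_eq_mul_left (by norm_num) (Nat.add_right_cancel h))]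

end Codes

/-! ### Enumerated theories, Craig's trick and RS = RE -/

section Enumeration

variable {L : FirstOrder.Language.{u, v}}

/-- A valid sentence. -/
def verum : L.Sentence := FirstOrder.Language.BoundedFormula.falsum.imp .falsum

theorem realize_verum (A : Struc.{u, v, w} L) : A ⊨ (verum : L.Sentence) := fun h => h

theorem computablePred_exists_le {f : ℕ → ℕ} (hf : Computable f) :
    ComputablePred fun k => ∃ j ≤ k, f j = k := by
  have h : Computable fun k : ℕ => Nat.rec (motive := fun _ => Bool) false
      (fun j b => b || decide (f j = k)) (k + 1) := by
    refine Computable.nat_rec (f := fun k => k + 1) (g := fun _ => false)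
      (h := fun k q => q.2 || decide (f q.1 = k)) Computable.succ (Computable.const _) ?_
    exact (Primrec.or.to_comp.comp (Computable.snd.comp Computable.snd)
      (Primrec.eq.decide.to_comp.comp (hf.comp (Computable.fst.comp Computable.snd))
        Computable.fst)).to₂
  refine ComputablePred.computable_iff.2 ⟨_, h, funext fun k => propext ?_⟩
  have : ∀ m, (Nat.rec (motive := fun _ => Bool) false
      (fun j b => b || decide (f j = k)) m = true) ↔ ∃ j < m, f j = k := by
    intro m
    induction m with
    | zero => simp
    | succ m ih =>
      change ((_ || _) = true) ↔ _
      rw [Bool.or_eq_true, ih, decide_eq_true_iff]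
      constructor
      · rintro (⟨j, hj, h⟩ | h)
        · exact ⟨j, by omega, h⟩
        · exact ⟨m, by omega, h⟩
      · rintro ⟨j, hj, h⟩
        rcases Nat.lt_succ_iff_lt_or_eq.1 hj with hj | rfl
        · exact Or.inl ⟨j, hj, h⟩
        · exact Or.inr h
  exact Iff.symm ((this (k + 1)).trans (by simp only [Nat.lt_succ_iff]))

/-- A sentence equivalent to `φ` whose code is at least `j`. -/
def pad (j : ℕ) (φ : L.Sentence) : L.Sentence :=
  (fun ψ : L.Sentence => FirstOrder.Language.BoundedFormula.imp verum ψ)^[j] φ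

theorem realize_pad (A : Struc.{u, v, w} L) (j : ℕ) (φ : L.Sentence) : A ⊨ pad j φ ↔ A ⊨ φ := by
  induction j with
  | zero => exact Iff.rfl
  | succ j ih =>
    rw [pad, Function.iterate_succ_apply']
    change (A ⊨ (verum : L.Sentence) → A ⊨ pad j φ) ↔ _
    rw [ih]
    exact ⟨fun h => h (realize_verum A), fun h _ => h⟩

variable [EffectiveSignature L]

theorem fmlCode_pad (j : ℕ) (φ : L.Sentence) :
    fmlCode (n := 0) (pad j φ) = (fun x => impCode (impCode 0 0) x)^[j] (fmlCode (n := 0) φ) := by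
  induction j with
  | zero => rfl
  | succ j ih =>
    rw [pad, Function.iterate_succ_apply', Function.iterate_succ_apply', ← ih]
    rfl

theorem le_fmlCode_pad (j : ℕ) (φ : L.Sentence) : j ≤ fmlCode (n := 0) (pad j φ) := by
  rw [fmlCode_pad]
  induction j with
  | zero => exact Nat.zero_le _
  | succ j ih =>
    rw [Function.iterate_succ_apply']
    have := Nat.right_le_pair (impCode 0 0)
      ((fun x => impCode (impCode 0 0) x)^[j] (fmlCode (n := 0) φ))
    change _ ≤ 4 * Nat.pair _ _ + 3
    omega

/-- Craig's trick: a computably enumerated theory has a recursive axiomatisation. -/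
theorem exists_recursiveTheory (φ : ℕ → L.Sentence)
    (hφ : Computable fun j => fmlCode (n := 0) (φ j)) :
    ∃ T : L.Theory, RecursiveTheory T ∧ ∀ A : Struc.{u, v, w} L, A ⊨ T ↔ ∀ j, A ⊨ φ j := by
  -- Since the `j`-th padded sentence has code at least `j`, whether `k` is a code of a member is
  -- settled by the indices `j ≤ k`.
  refine ⟨Set.range fun j => pad j (φ j), ?_, fun A => ?_⟩
  · have h : Computable fun j => fmlCode (n := 0) (pad j (φ j)) := by
      simp only [fmlCode_pad]
      have hit : Primrec₂ fun j x : ℕ => (fun x => impCode (impCode 0 0) x)^[j] x :=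
        Primrec.nat_iterate Primrec.fst Primrec.snd
          (primrec_impCode.comp (Primrec.const _) Primrec.snd).to₂
      exact hit.to_comp.comp Computable.id hφ
    refine (computablePred_exists_le h).of_eq fun k => ?_
    constructor
    · rintro ⟨j, -, hj⟩
      exact ⟨_, ⟨j, rfl⟩, hj⟩
    · rintro ⟨_, ⟨j, rfl⟩, hj⟩
      exact ⟨j, hj ▸ le_fmlCode_pad j (φ j), hj⟩
  · rw [FirstOrder.Language.Theory.model_iff]
    simp [realize_pad]

/-- The code of the sentence given by the finite part of a separation rule and a list of
clauses of it. -/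
def ruleSentenceCode (h : ℕ) (cs : List ℕ) : ℕ :=
  if h % 2 = 0 then h / 2
  -- Omitting `K` from the head leaves the code of the clause `⟨N, μ, η⟩`, from which the
  -- approximation starts.
  else approxCode (Nat.pair (h / 2).unpair.1 (h / 2).unpair.2.unpair.2) cs

theorem primrec_ruleSentenceCode : Primrec₂ ruleSentenceCode := by
  have h2 : Primrec fun q : ℕ × List ℕ => q.1 / 2 := Primrec.nat_div.comp Primrec.fst (.const 2)
  have hu : Primrec fun q : ℕ × List ℕ => (q.1 / 2).unpair := Primrec.unpair.comp h2
  have h0 : Primrec fun q : ℕ × List ℕ => Nat.pair (q.1 / 2).unpair.1 (q.1 / 2).unpair.2.unpair.2 :=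
    Primrec₂.natPair.comp (Primrec.fst.comp hu)
      (Primrec.snd.comp (Primrec.unpair.comp (Primrec.snd.comp hu)))
  have ha : Primrec fun q : ℕ × List ℕ =>
      approxCode (Nat.pair (q.1 / 2).unpair.1 (q.1 / 2).unpair.2.unpair.2) q.2 :=
    primrec_approxCode.comp h0 Primrec.snd
  exact (Primrec.ite (Primrec.eq.comp (Primrec.nat_mod.comp Primrec.fst (.const 2)) (.const 0))
    h2 ha).to₂

theorem exists_approximation_code (σ : SepRule L) (cs : List ℕ) (hcs : ∀ k ∈ cs, k ∈ σ.clauseCodes) :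
    ∃ φ ∈ σ.approximations, fmlCode (n := 0) φ = ruleSentenceCode σ.headCode cs := by
  cases σ with
  | sentence φ => exact ⟨φ, rfl, by simp [ruleSentenceCode, SepRule.headCode]⟩
  | rule N K hK μ η τ =>
    have : ∃ ds : List (Clause L K), (∀ d ∈ ds, d ∈ τ) ∧ ds.map Clause.code = cs := by
      induction cs with
      | nil => exact ⟨[], by simp, rfl⟩
      | cons k cs ih =>
        obtain ⟨ds, hds, rfl⟩ := ih fun k hk => hcs k (by simp [hk])
        obtain ⟨d, hd, rfl⟩ := hcs k (by simp)
        exact ⟨d :: ds, by simpa [hd] using hds, rfl⟩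
    obtain ⟨ds, hds, rfl⟩ := this
    refine ⟨_, ⟨ds, hds, rfl⟩, ?_⟩
    rw [Clause.fmlCode_approx, ruleSentenceCode, if_neg (by simp only [SepRule.headCode]; omega)]
    have : ∀ x : ℕ, (2 * x + 1) / 2 = x := fun x => by omega
    simp [SepRule.headCode, this, Clause.code]

theorem exists_code_of_mem_approximations (σ : SepRule L) {φ : L.Sentence}
    (hφ : φ ∈ σ.approximations) :
    ∃ cs : List ℕ, (∀ k ∈ cs, k ∈ σ.clauseCodes) ∧
      fmlCode (n := 0) φ = ruleSentenceCode σ.headCode cs := by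
  cases σ with
  | sentence ψ =>
    obtain rfl : φ = ψ := hφ
    exact ⟨[], by simp, by simp [ruleSentenceCode, SepRule.headCode]⟩
  | rule N K hK μ η τ =>
    obtain ⟨ds, hds, rfl⟩ := hφ
    refine ⟨ds.map Clause.code, fun k hk => ?_, ?_⟩
    · obtain ⟨d, hd, rfl⟩ := List.mem_map.1 hk
      exact ⟨d, hds d hd, rfl⟩
    · rw [Clause.fmlCode_approx, ruleSentenceCode, if_neg (by simp only [SepRule.headCode]; omega)]
      have : ∀ x : ℕ, (2 * x + 1) / 2 = x := fun x => by omega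
      simp [SepRule.headCode, this, Clause.code]

/-- A recursively enumerable relation is the projection of a monotone primitive recursive one. -/
theorem exists_stages {p : ℕ × ℕ → Prop} (hp : REPred p) :
    ∃ R : ℕ → ℕ × ℕ → Prop, PrimrecRel R ∧ (∀ q, p q ↔ ∃ s, R s q) ∧
      ∀ s s' q, s ≤ s' → R s q → R s' q := by
  obtain ⟨c, hc⟩ := Nat.Partrec.Code.exists_code.1 hp
  -- The stage `s` is the bound given to the evaluation of a program that halts exactly on `p`.
  refine ⟨fun s q => (Nat.Partrec.Code.evaln s c (Encodable.encode q)).isSome = true, ?_, ?_, ?_⟩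
  · exact Primrec.eq.comp (Primrec.option_isSome.comp (Nat.Partrec.Code.primrec_evaln.comp
      (Primrec.pair (Primrec.pair Primrec.fst (.const c)) (Primrec.encode.comp Primrec.snd))))
      (.const true)
  · intro q
    have hq : p q ↔ (c.eval (Encodable.encode q)).Dom := by
      rw [hc]
      obtain ⟨a, b⟩ := q
      simp [Part.assert, Encodable.encode_prod_val]
    rw [hq, Part.dom_iff_mem]
    simp only [Nat.Partrec.Code.evaln_complete, Option.isSome_iff_exists]
    exact exists_comm
  · intro s s' q hs h
    obtain ⟨x, hx⟩ := Option.isSome_iff_exists.1 h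
    exact Option.isSome_iff_exists.2 ⟨x, Nat.Partrec.Code.evaln_mono hs hx⟩

theorem RS_subset_RE {𝒜 : Set (Struc.{u, v, w} L)} : RS 𝒜 ⊆ RE 𝒜 := by
  classical
  rintro _ ⟨_, ⟨σ, rfl, hhead, hclauses⟩, rfl⟩
  obtain ⟨R, hR, hpR, hmono⟩ := exists_stages hclauses
  -- An index `j` encodes a rule number, a stage and a list of clause codes. It is admissible if all
  -- these codes have been listed for that rule by that stage.
  let admissible : ℕ → Prop := fun j =>
    ∀ k ∈ (Denumerable.ofNat (ℕ × ℕ × List ℕ) j).2.2,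
      R (Denumerable.ofNat (ℕ × ℕ × List ℕ) j).2.1 ((Denumerable.ofNat (ℕ × ℕ × List ℕ) j).1, k)
  let f : ℕ → ℕ := fun j =>
    if admissible j then ruleSentenceCode (σ (Denumerable.ofNat (ℕ × ℕ × List ℕ) j).1).headCode
      (Denumerable.ofNat (ℕ × ℕ × List ℕ) j).2.2
    -- This is the code of `verum`, a harmless output at inadmissible indices.
    else impCode 0 0
  have hf : Computable f := by
    have hd : Primrec fun j : ℕ => Denumerable.ofNat (ℕ × ℕ × List ℕ) j := Primrec.ofNat _
    have ha : ComputablePred admissible := by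
      have hR' : PrimrecRel fun (k : ℕ) (q : ℕ × ℕ × List ℕ) => R q.2.1 (q.1, k) :=
        hR.comp (Primrec.fst.comp (Primrec.snd.comp Primrec.snd))
          (Primrec.pair (Primrec.fst.comp Primrec.snd) Primrec.fst)
      exact (hR'.forall_mem_list.comp (Primrec.snd.comp (Primrec.snd.comp hd)) hd).computablePred
    exact ComputablePred.ite (primrec_ruleSentenceCode.to_comp.comp
      (hhead.comp (Primrec.fst.comp hd).to_comp)
      (Primrec.snd.comp (Primrec.snd.comp hd)).to_comp) (Computable.const _) ha
  have hφ : ∀ j, ∃ φ : L.Sentence, fmlCode (n := 0) φ = f j ∧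
      (φ = verum ∨ ∃ n, φ ∈ (σ n).approximations) := by
    intro j
    by_cases h : admissible j
    · obtain ⟨φ, hφ, hc⟩ := exists_approximation_code
        (σ (Denumerable.ofNat (ℕ × ℕ × List ℕ) j).1) _ fun k hk => (hpR (_, k)).2 ⟨_, h k hk⟩
      exact ⟨φ, by rw [hc]; exact (if_pos h).symm, Or.inr ⟨_, hφ⟩⟩
    · exact ⟨verum, (if_neg h).symm, Or.inl rfl⟩
  choose φ hφc hφm using hφ
  obtain ⟨T, hT, hTA⟩ := exists_recursiveTheory.{u, v, w} φ (hf.of_eq fun j => (hφc j).symm)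
  refine ⟨T, hT, ?_⟩
  rw [definedBy_eq_models]
  ext A
  refine and_congr_right fun _ => ?_
  rw [hTA, FirstOrder.Language.Theory.model_iff]
  constructor
  · intro h j
    rcases hφm j with hj | ⟨n, hn⟩
    · rw [hj]
      exact realize_verum A
    · exact h _ (Set.mem_biUnion ⟨n, rfl⟩ hn)
  · intro h ψ hψ
    obtain ⟨_, ⟨n, rfl⟩, hψ⟩ := Set.mem_iUnion₂.1 hψ
    obtain ⟨cs, hcs, hc⟩ := exists_code_of_mem_approximations _ hψ
    -- Monotonicity of the stages gives one stage that serves the whole finite list.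
    obtain ⟨s, hs⟩ : ∃ s, ∀ k ∈ cs, R s (n, k) := by
      clear hc
      induction cs with
      | nil => exact ⟨0, by simp⟩
      | cons k cs ih =>
        obtain ⟨s, hs⟩ := ih fun k hk => hcs k (by simp [hk])
        obtain ⟨s', hs'⟩ := (hpR (n, k)).1 (hcs k (by simp))
        refine ⟨max s s', fun k' hk' => ?_⟩
        rcases List.mem_cons.1 hk' with rfl | hk'
        · exact hmono _ _ _ (le_max_right _ _) hs'
        · exact hmono _ _ _ (le_max_left _ _) (hs k' hk')
    have hj : φ (Encodable.encode (n, s, cs)) = ψ := by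
      refine fmlCode_injective ((hφc _).trans (Eq.trans ?_ hc.symm))
      simp only [f, admissible, Denumerable.ofNat_encode]
      exact if_pos hs
    exact hj ▸ h _

theorem RE_subset_RS {𝒜 : Set (Struc.{u, v, w} L)} : RE 𝒜 ⊆ RS 𝒜 := by
  classical
  rintro _ ⟨T, hT, rfl⟩
  -- The theory is enumerated by the codes themselves, with a valid sentence at every number that is
  -- not the code of a member.
  let φ : ℕ → L.Sentence := fun k =>
    if h : ∃ φ ∈ T, fmlCode (n := 0) φ = k then h.choose else verum
  have hφ : Computable fun k => fmlCode (n := 0) (φ k) := by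
    refine (ComputablePred.ite Computable.id (Computable.const (impCode 0 0)) hT).of_eq fun k => ?_
    by_cases h : ∃ φ ∈ T, fmlCode (n := 0) φ = k
    · simp only [φ, dif_pos h, if_pos h]
      exact h.choose_spec.2.symm
    · simp only [φ, dif_neg h, if_neg h]
      rfl
  refine ⟨Set.range fun k => .sentence (φ k), ⟨_, rfl, ?_, ?_⟩, ?_⟩
  · exact (Primrec.nat_mul.comp (.const 2) .id).to_comp.comp hφ
  · exact (ComputablePred.computable_iff.2 ⟨fun _ => false, Computable.const _, by
      funext p; simp [SepRule.clauseCodes]⟩ : ComputablePred _).to_re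
  · ext A
    refine and_congr_right fun _ => ?_
    rw [FirstOrder.Language.Theory.model_iff]
    simp only [Set.forall_mem_range, SepRule.Holds]
    constructor
    · intro h k
      by_cases hk : ∃ φ ∈ T, fmlCode (n := 0) φ = k
      · simp only [φ, dif_pos hk]
        exact h _ hk.choose_spec.1
      · simp only [φ, dif_neg hk]
        exact realize_verum A
    · intro h ψ hψ
      have hk : ∃ φ ∈ T, fmlCode (n := 0) φ = fmlCode (n := 0) ψ := ⟨ψ, hψ, rfl⟩
      have := h (fmlCode (n := 0) ψ)
      simp only [φ, dif_pos hk] at this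
      rwa [fmlCode_injective hk.choose_spec.2] at this

/-- Finitely many finite objects form a lookup table of codes, and reading a table is computable. -/
theorem FS_subset_RS {𝒜 : Set (Struc.{u, v, w} L)} : FS 𝒜 ⊆ RS 𝒜 := by
  classical
  rintro _ ⟨Sch, ⟨hfin, hfinite⟩, rfl⟩
  let l := hfin.toFinset.toList
  have hl : ∀ σ, σ ∈ l ↔ σ ∈ Sch := by simp [l]
  have hcodes : ∀ σ ∈ Sch, σ.clauseCodes.Finite := by
    intro σ hσ
    cases σ with
    | sentence φ => exact Set.finite_empty
    | rule N K hK μ η τ => exact (hfinite _ hσ).image Clause.code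
  let codes : SepRule L → List ℕ := fun σ =>
    if h : σ.clauseCodes.Finite then h.toFinset.toList else []
  let σ : ℕ → SepRule L := fun n => l.getD n (.sentence verum)
  have hσ : ∀ n, σ n ∈ Sch ∨ σ n = .sentence verum := by
    intro n
    by_cases h : n < l.length
    · exact Or.inl ((hl _).1 (by simp [σ, h]))
    · exact Or.inr (by simp [σ, not_lt.1 h])
  refine ⟨Set.range σ, ⟨σ, rfl, ?_, ?_⟩, ?_⟩
  · have h : Primrec fun n => (l.map SepRule.headCode).getD n
        (SepRule.headCode (.sentence (verum : L.Sentence))) :=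
      (Primrec.list_getD _).comp (.const _) .id
    exact h.to_comp.of_eq fun n => by rw [List.getD_map]
  · have h : PrimrecRel fun (c : List ℕ) (k : ℕ) => ∃ a ∈ c, a = k :=
      PrimrecRel.exists_mem_list Primrec.eq
    have h' := (h.comp ((Primrec.list_getD []).comp (.const (l.map codes)) Primrec.fst)
      Primrec.snd).computablePred.to_re
    refine h'.of_eq fun p => ?_
    -- The default entry of the table has no clauses, so the default value `[]` of the list of code
    -- lists is the right one.
    have hn : codes (.sentence verum) = [] := by
      simp [codes, SepRule.clauseCodes]
    rw [← hn, List.getD_map]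
    change (∃ a ∈ codes (σ p.1), a = p.2) ↔ _
    have hc : (σ p.1).clauseCodes.Finite := by
      rcases hσ p.1 with h | h
      · exact hcodes _ h
      · rw [h]; exact Set.finite_empty
    simp [codes, hc]
  · ext A
    refine and_congr_right fun _ => ?_
    rw [Set.forall_mem_range]
    constructor
    · intro h n
      rcases hσ n with hn | hn
      · exact h _ hn
      · rw [hn]; exact realize_verum A
    · intro h τ hτ
      obtain ⟨n, hn, rfl⟩ := List.getElem_of_mem ((hl τ).2 hτ)
      have := h n
      simpa [σ, hn] using this

theorem RS_eq_RE {𝒜 : Set (Struc.{u, v, w} L)} : RS 𝒜 = RE 𝒜 :=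
  Set.Subset.antisymm RS_subset_RE RE_subset_RS

end Enumeration

/-! ### A signature for the counterexamples -/

/-- The signature with countably many function symbols and relation symbols of each arity. -/
def symbols : FirstOrder.Language.{u, v} := ⟨fun _ => ULift.{u} ℕ, fun _ => ULift.{v} ℕ⟩

instance : EffectiveSignature symbols.{u, v} where
  funCode _ f := f.down
  relCode _ R := R.down
  funCode_injective _ := ULift.down_injective
  relCode_injective _ := ULift.down_injective
  computable_fun := (PrimrecPred.computablePred (Primrec.eq.comp (.const 0) (.const 0))).of_eq
    fun p => ⟨fun _ => ⟨⟨p.2⟩, rfl⟩, fun _ => rfl⟩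
  computable_rel := (PrimrecPred.computablePred (Primrec.eq.comp (.const 0) (.const 0))).of_eq
    fun p => ⟨fun _ => ⟨⟨p.2⟩, rfl⟩, fun _ => rfl⟩

theorem isElementary_univ {L : FirstOrder.Language.{u, v}} :
    IsElementary (Set.univ : Set (Struc.{u, v, w} L)) :=
  ⟨∅, by ext A; simp⟩

/-! ### One-element structures: RE is not in FS, E is not in RE -/

section Propositional

/-- The one-element structure in which the relation symbols with number in `X` hold. -/
def unitModel (X : Set ℕ) : Struc.{u, v, w} symbols :=
  letI : symbols.{u, v}.Structure PUnit.{w + 1} :=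
    { funMap := fun _ _ => PUnit.unit, RelMap := fun R _ => R.down ∈ X }
  FirstOrder.Language.Theory.ModelType.of ∅ PUnit.{w + 1}

instance (X : Set ℕ) : Subsingleton (unitModel.{u, v, w} X) :=
  inferInstanceAs (Subsingleton PUnit)

/-- Two sets of numbers agree below `m`. -/
def Agree (m : ℕ) (X Y : Set ℕ) : Prop := ∀ k < m, k ∈ X ↔ k ∈ Y

theorem Agree.mono {m m' : ℕ} {X Y : Set ℕ} (h : Agree m' X Y) (hm : m ≤ m') : Agree m X Y :=
  fun k hk => h k (hk.trans_le hm)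

/-- In a one-element structure all equations hold and quantifiers are idle, so only the finitely
many relation symbols in the formula matter. -/
theorem exists_agree_fml {n : ℕ} (φ : Fml symbols.{u, v} n) : ∃ m, ∀ X Y, Agree m X Y →
    ∀ (a : Fin n → unitModel.{u, v, w} X) (b : Fin n → unitModel.{u, v, w} Y),
      Holds _ φ a ↔ Holds _ φ b := by
  induction φ with
  | falsum => exact ⟨0, fun X Y _ a b => Iff.rfl⟩
  | equal s t => exact ⟨0, fun X Y _ a b => iff_of_true (Subsingleton.elim _ _) (Subsingleton.elim _ _)⟩
  | rel R ts => exact ⟨R.down + 1, fun X Y h a b => h _ (Nat.lt_succ_self _)⟩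
  | imp φ ψ hφ hψ =>
    obtain ⟨m, hm⟩ := hφ
    obtain ⟨m', hm'⟩ := hψ
    exact ⟨max m m', fun X Y h a b => imp_congr (hm X Y (h.mono (le_max_left _ _)) a b)
      (hm' X Y (h.mono (le_max_right _ _)) a b)⟩
  | all φ ih =>
    obtain ⟨m, hm⟩ := ih
    exact ⟨m, fun X Y h a b => ⟨fun H y => (hm X Y h _ _).1 (H PUnit.unit),
      fun H x => (hm X Y h _ _).2 (H PUnit.unit)⟩⟩

theorem exists_agree_QF {K n : ℕ} (θ : QF symbols.{u, v} K n) : ∃ m, ∀ X Y, Agree m X Y →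
    ∀ (S : Fin K → Set PUnit.{w + 1}) (a : Fin n → PUnit.{w + 1}),
      QF.Holds (unitModel X) S a θ ↔ QF.Holds (unitModel Y) S a θ := by
  induction θ with
  | falsum => exact ⟨0, fun X Y _ S a => Iff.rfl⟩
  | equal s t =>
    exact ⟨0, fun X Y _ S a => iff_of_true (Subsingleton.elim _ _) (Subsingleton.elim _ _)⟩
  | rel R ts => exact ⟨R.down + 1, fun X Y h S a => h _ (Nat.lt_succ_self _)⟩
  | mem k t => exact ⟨0, fun X Y _ S a => Iff.rfl⟩
  | imp φ ψ hφ hψ =>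
    obtain ⟨m, hm⟩ := hφ
    obtain ⟨m', hm'⟩ := hψ
    exact ⟨max m m', fun X Y h S a => imp_congr (hm X Y (h.mono (le_max_left _ _)) S a)
      (hm' X Y (h.mono (le_max_right _ _)) S a)⟩

theorem exists_agree_clause {K : ℕ} (c : Clause symbols.{u, v} K) : ∃ m, ∀ X Y, Agree m X Y →
    ∀ S : Fin K → Set PUnit.{w + 1},
      Clause.Holds (unitModel X) S c ↔ Clause.Holds (unitModel Y) S c := by
  obtain ⟨m, hm⟩ := exists_agree_fml.{u, v, w} c.γ
  obtain ⟨m', hm'⟩ := exists_agree_QF.{u, v, w} c.ψ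
  exact ⟨max m m', fun X Y h S => forall_congr' fun b =>
    imp_congr (hm X Y (h.mono (le_max_left _ _)) b b) (hm' X Y (h.mono (le_max_right _ _)) S b)⟩

/-- `P` is not assumed monotone in `m`; hence each element keeps its own `m`, bounded by `M`. -/
theorem exists_common_bound {α : Type*} {s : Set α} (hs : s.Finite) {P : α → ℕ → Prop}
    (h : ∀ x, ∃ m, P x m) : ∃ M, ∀ x ∈ s, ∃ m ≤ M, P x m := by
  choose f hf using h
  obtain ⟨M, hM⟩ := (hs.image f).bddAbove
  exact ⟨M, fun x hx => ⟨f x, hM ⟨x, hx, rfl⟩, hf x⟩⟩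

/-- Both structures have the same carrier, so the same predicates can be tried in each. Finiteness
is a premiss inside the existential, so that `exists_common_bound` applies, which wants a bound for
every rule. -/
theorem exists_agree_rule (σ : SepRule symbols.{u, v}) : ∃ m, σ.IsFinite → ∀ X Y, Agree m X Y →
    (σ.Holds (unitModel.{u, v, w} X) ↔ σ.Holds (unitModel.{u, v, w} Y)) := by
  cases σ with
  | sentence φ =>
    obtain ⟨m, hm⟩ := exists_agree_fml.{u, v, w} (n := 0) φ
    exact ⟨m, fun _ X Y h => hm X Y h default default⟩
  | rule N K hK μ η τ =>
    by_cases hτ : τ.Finite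
    · obtain ⟨m₁, h₁⟩ := exists_agree_fml.{u, v, w} μ
      obtain ⟨m₂, h₂⟩ := exists_agree_QF.{u, v, w} η
      obtain ⟨m₃, h₃⟩ := exists_common_bound hτ exists_agree_clause.{u, v, w}
      refine ⟨max m₁ (max m₂ m₃), fun _ X Y h => forall_congr' fun a =>
        imp_congr (h₁ X Y (h.mono (by omega)) a a) (exists_congr fun S =>
          and_congr (h₂ X Y (h.mono (by omega)) S a) (forall₂_congr fun c hc => ?_))⟩
      obtain ⟨m, hm, hc⟩ := h₃ c hc
      exact hc X Y (h.mono (by omega)) S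
    · exact ⟨0, fun h => absurd h hτ⟩

/-- The atomic sentence given by a relation symbol without arguments. -/
def atomSentence (n : ℕ) : symbols.{u, v}.Sentence :=
  FirstOrder.Language.BoundedFormula.rel (l := 0) (⟨n⟩ : ULift.{v} ℕ) Fin.elim0

theorem realize_atomSentence (X : Set ℕ) (n : ℕ) :
    unitModel.{u, v, w} X ⊨ atomSentence.{u, v} n ↔ n ∈ X := Iff.rfl

theorem not_RE_subset_FS : ¬ RE (Set.univ : Set (Struc.{u, v, w} symbols.{u, v})) ⊆ FS Set.univ := by
  intro hsub
  have hcode : Computable fun n => fmlCode (n := 0) (atomSentence.{u, v} n) := by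
    have h : Primrec fun n : ℕ => 4 * Nat.pair 0 (Nat.pair n (Encodable.encode ([] : List ℕ))) + 2 :=
      Primrec.nat_add.comp (Primrec.nat_mul.comp (.const 4) (Primrec₂.natPair.comp (.const 0)
        (Primrec₂.natPair.comp .id (.const _)))) (.const 2)
    exact h.to_comp
  obtain ⟨T, hT, hTA⟩ := exists_recursiveTheory.{u, v, w} atomSentence.{u, v} hcode
  obtain ⟨Sch, ⟨hfin, hfinite⟩, hSch⟩ := hsub ⟨T, hT, rfl⟩
  obtain ⟨m, hm⟩ := exists_common_bound hfin exists_agree_rule.{u, v, w}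
  have huniv : unitModel.{u, v, w} Set.univ ∈ definedBy Set.univ Sch := by
    rw [← hSch]
    exact ⟨trivial, (hTA _).2 fun n => (realize_atomSentence.{u, v, w} _ n).2 trivial⟩
  -- With `m` bounding all symbols that matter, the structure in which exactly the relations below
  -- `m` hold satisfies the scheme, yet its `m`-th atom fails.
  have hY : unitModel.{u, v, w} {k | k < m} ∈ definedBy Set.univ Sch := by
    refine ⟨trivial, fun σ hσ => ?_⟩
    obtain ⟨m', hm', h⟩ := hm σ hσ
    exact (h (hfinite σ hσ) Set.univ _ fun k hk =>
      iff_of_true trivial (hk.trans_le hm')).1 (huniv.2 σ hσ)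
  rw [← hSch] at hY
  exact lt_irrefl m ((realize_atomSentence.{u, v, w} _ m).1 ((hTA _).1 hY.2 m))

theorem not_E_subset_RE : ¬ E (Set.univ : Set (Struc.{u, v, w} symbols.{u, v})) ⊆ RE Set.univ := by
  intro hsub
  let ℬ : Set ℕ → Set (Struc.{u, v, w} symbols.{u, v}) := fun X => {A | A ⊨ atomSentence '' X}
  have hℬ : ∀ X Y, unitModel X ∈ ℬ Y ↔ Y ⊆ X := by
    intro X Y
    change _ ⊨ (_ : FirstOrder.Language.Theory _) ↔ _
    rw [FirstOrder.Language.Theory.model_iff, Set.forall_mem_image]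
    rfl
  have hinj : Function.Injective ℬ := by
    intro X Y h
    refine Set.Subset.antisymm ?_ ?_
    · rw [← hℬ, h, hℬ]
    · rw [← hℬ, ← h, hℬ]
  choose T hT hTℬ using fun X => hsub ⟨Set.subset_univ (ℬ X), _, rfl⟩
  choose f hf hfT using fun X => ComputablePred.computable_iff.1 (hT X)
  have hcount : Countable {f : ℕ → ℕ // Computable f} := inferInstance
  obtain ⟨c, hc⟩ := hcount.exists_injective_nat
  -- Mapping `X` to the number of a decision procedure for a theory of `ℬ X` would inject the sets
  -- of numbers into the numbers.
  refine Function.cantor_injective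
    (fun X : Set ℕ => c ⟨fun k => Encodable.encode (f X k), Computable.encode.comp (hf X)⟩) ?_
  intro X Y h
  have h : ∀ k, f X k = f Y k := fun k =>
    Encodable.encode_injective (congrFun (congrArg Subtype.val (hc h)) k)
  have hTXY : T X = T Y := by
    have hcodes : ∀ k, (∃ φ ∈ T X, fmlCode (n := 0) φ = k) ↔ ∃ φ ∈ T Y, fmlCode (n := 0) φ = k := by
      exact fun k => iff_of_eq ((congrFun (hfT X) k).trans
        ((congrArg (· = true) (h k)).trans (congrFun (hfT Y) k).symm))
    ext φ
    constructor
    · intro hφ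
      obtain ⟨ψ, hψ, he⟩ := (hcodes _).1 ⟨φ, hφ, rfl⟩
      exact fmlCode_injective he ▸ hψ
    · intro hφ
      obtain ⟨ψ, hψ, he⟩ := (hcodes _).2 ⟨φ, hφ, rfl⟩
      exact fmlCode_injective he ▸ hψ
  exact hinj (by rw [hTℬ X, hTℬ Y, hTXY])

end Propositional

/-! ### Unreachability: FS is not in FE -/

section Reachability

/-- The `m`-th iterate of a unary function symbol at a constant. -/
def iterTerm {n : ℕ} : ℕ → Trm symbols.{u, v} n
  | 0 => .func (l := 0) (⟨0⟩ : ULift.{u} ℕ) Fin.elim0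
  | m + 1 => .func (l := 1) (⟨0⟩ : ULift.{u} ℕ) fun _ => iterTerm m

/-- Another constant. -/
def targetTerm {n : ℕ} : Trm symbols.{u, v} n := .func (l := 0) (⟨1⟩ : ULift.{u} ℕ) Fin.elim0

/-- The sentence saying that the second constant is not the `m`-th iterate at the first. -/
def avoids (m : ℕ) : symbols.{u, v}.Sentence :=
  .imp (.equal (iterTerm m) targetTerm) .falsum

/-- The rule saying that the second constant can be separated from the first by a set that is
closed under the unary function. -/
def unreachable : SepRule symbols.{u, v} :=
  .rule 0 1 le_rfl (.imp .falsum .falsum)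
    (.and (.mem 0 (iterTerm 0)) (.imp (.mem 0 targetTerm) .falsum))
    {⟨1, .imp .falsum .falsum, .imp (.mem 0 (.var (.inr 0)))
      (.mem 0 (.func (l := 1) (⟨0⟩ : ULift.{u} ℕ) fun _ => .var (.inr 0)))⟩}

/-- A closed set containing the first constant contains all iterates; conversely, the set of
iterates is itself closed and serves as the separating set. -/
theorem unreachable_holds_iff (A : Struc.{u, v, w} symbols.{u, v}) :
    unreachable.Holds A ↔ ∀ m, A ⊨ avoids.{u, v} m := by
  constructor
  · intro h m hm
    obtain ⟨S, hη, hτ⟩ := h Fin.elim0 id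
    rw [QF.holds_and] at hη
    have hmem : ∀ m, value A (iterTerm m) Fin.elim0 ∈ S 0 := by
      intro m
      induction m with
      | zero => exact hη.1
      | succ m ih => exact hτ _ rfl (fun _ => value A (iterTerm m) Fin.elim0) id ih
    have hm : value A (iterTerm m) default = value A targetTerm default := hm
    rw [Subsingleton.elim default Fin.elim0] at hm
    have ht : value A targetTerm Fin.elim0 ∈ S 0 := hm ▸ hmem m
    exact hη.2 ht
  · intro h a _
    refine ⟨fun _ => Set.range fun m => value A (iterTerm m) a, ?_, ?_⟩
    · rw [QF.holds_and]
      refine ⟨⟨0, rfl⟩, ?_⟩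
      rintro ⟨m, hm⟩
      have hm : value A (iterTerm m) a = value A targetTerm a := hm
      rw [Subsingleton.elim a default] at hm
      exact h m hm
    · rintro _ rfl b _ ⟨m, hm⟩
      refine ⟨m + 1, ?_⟩
      exact congrArg (fun x => FirstOrder.Language.Structure.funMap (M := A)
        (L := symbols.{u, v}) (n := 1) (⟨0⟩ : ULift.{u} ℕ) fun _ => x) hm

/-- The natural numbers with the successor function and the constants `0` and `n`. -/
def chainModel (n : ℕ) : Struc.{u, v, w} symbols :=
  letI : symbols.{u, v}.Structure (ULift.{w} ℕ) :=
    { funMap := fun {l} f a => match l, a with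
        -- Constant number 0 denotes `0`; all others, in particular the target number 1, denote `n`.
        | 0, _ => ⟨if f.down = 0 then 0 else n⟩
        | _ + 1, a => ⟨(a 0).down + 1⟩
      RelMap := fun _ _ => False }
  FirstOrder.Language.Theory.ModelType.of ∅ (ULift.{w} ℕ)

theorem value_iterTerm_chainModel (n m : ℕ) (a : Fin 0 → chainModel.{u, v, w} n) :
    value _ (iterTerm m) a = (⟨m⟩ : ULift.{w} ℕ) := by
  induction m with
  | zero => rfl
  | succ m ih =>
    have : (value _ (iterTerm (m + 1)) a : ULift.{w} ℕ) =
      ⟨(value _ (iterTerm m) a : ULift.{w} ℕ).down + 1⟩ := rfl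
    rw [this, ih]

theorem chainModel_avoids_iff (n m : ℕ) : chainModel.{u, v, w} n ⊨ avoids.{u, v} m ↔ m ≠ n := by
  have h : chainModel.{u, v, w} n ⊨ avoids.{u, v} m ↔
      ¬ (value (chainModel.{u, v, w} n) (iterTerm m) default : ULift.{w} ℕ) = ⟨n⟩ := Iff.rfl
  rw [h, value_iterTerm_chainModel]
  exact not_congr ⟨fun h => congrArg ULift.down h, fun h => congrArg ULift.up h⟩

/-- Each `chainModel n` violates the rule, at the single sentence `avoids n`. A nonprincipal
ultraproduct therefore satisfies every `avoids m`, and a finite axiomatisation would pass by Łoś's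
theorem from it to some `chainModel n`. -/
theorem not_FS_subset_FE : ¬ FS (Set.univ : Set (Struc.{u, v, w} symbols.{u, v})) ⊆ FE Set.univ := by
  intro hsub
  have hfin : EssFinite {(unreachable : SepRule symbols.{u, v})} := by
    refine ⟨Set.finite_singleton _, ?_⟩
    rintro _ rfl
    exact Set.finite_singleton _
  obtain ⟨T, hT, hTℬ⟩ := hsub ⟨_, hfin, rfl⟩
  have hmodels : ∀ A : Struc.{u, v, w} symbols.{u, v}, A ⊨ T ↔ ∀ m, A ⊨ avoids.{u, v} m := by
    intro A
    rw [← unreachable_holds_iff]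
    have := Set.ext_iff.1 hTℬ A
    simpa [definedBy] using this.symm
  let U := Filter.hyperfilter ℕ
  let P : Struc.{u, v, w} symbols.{u, v} := FirstOrder.Language.Theory.ModelType.of ∅
    ((U : Filter ℕ).Product fun n => (chainModel.{u, v, w} n : Type w))
  have hlos : ∀ φ : symbols.{u, v}.Sentence,
      P ⊨ φ ↔ ∀ᶠ n in (U : Filter ℕ), chainModel.{u, v, w} n ⊨ φ := fun φ =>
    FirstOrder.Language.Ultraproduct.sentence_realize φ
  have hP : P ⊨ T := by
    refine (hmodels P).2 fun m => (hlos _).2 ?_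
    simp only [chainModel_avoids_iff]
    have : {m}ᶜ ∈ (U : Filter ℕ) := Filter.compl_mem_hyperfilter_of_finite (Set.finite_singleton m)
    exact Filter.mem_of_superset this fun n hn h => hn h.symm
  rw [FirstOrder.Language.Theory.model_iff] at hP
  obtain ⟨n, hn⟩ := ((Filter.eventually_all_finite hT).2 fun φ hφ => (hlos φ).1 (hP φ hφ)).exists
  exact (chainModel_avoids_iff n n).1
    ((hmodels _).1 ((FirstOrder.Language.Theory.model_iff _).2 hn) n) rfl

end Reachability

/-! ### The exact set of inclusions -/

section Diagram

/-- An inclusion that holds for all effective signatures and elementary classes. -/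
def Included (X Y : Kind) : Prop :=
  ∀ (L : FirstOrder.Language.{u, v}) [EffectiveSignature L] (𝒜 : Set (Struc.{u, v, w} L)),
    IsElementary 𝒜 → X.subclasses 𝒜 ⊆ Y.subclasses 𝒜

theorem Included.trans {X Y Z : Kind} (h : Included.{u, v, w} X Y) (h' : Included.{u, v, w} Y Z) :
    Included.{u, v, w} X Z := fun L _ 𝒜 h𝒜 => (h L 𝒜 h𝒜).trans (h' L 𝒜 h𝒜)

theorem Arrow.included {X Y : Kind} (h : Arrow X Y) : Included.{u, v, w} X Y := by
  intro L _ 𝒜 h𝒜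
  cases h with
  | FS_RS => exact FS_subset_RS
  | RS_S => exact fun _ ⟨Sch, _, h⟩ => ⟨Sch, h⟩
  | FE_RE => exact FE_subset_FS.trans (FS_subset_RS.trans RS_subset_RE)
  | RE_E =>
    rintro _ ⟨T, -, rfl⟩
    exact models_mem_E h𝒜 T
  | FE_FS => exact FE_subset_FS
  | RE_RS => exact RE_subset_RS
  | RS_RE => exact RS_subset_RE
  | E_S => exact (S_eq_E h𝒜).superset
  | S_E => exact (S_eq_E h𝒜).subset

theorem included_of_path {X Y : Kind} (h : Relation.ReflTransGen Arrow X Y) :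
    Included.{u, v, w} X Y := by
  induction h with
  | refl => exact fun L _ 𝒜 _ => Set.Subset.rfl
  | tail _ h ih => exact ih.trans h.included

/-- The height of a vertex of the diagram. -/
def Kind.level : Kind → ℕ
  | .FE => 0
  | .FS => 1
  | .RS => 2
  | .RE => 2
  | .S => 3
  | .E => 3

/-- A vertex of given height. -/
def Kind.ofLevel : ℕ → Kind
  | 0 => .FE
  | 1 => .FS
  | 2 => .RS
  | _ => .S

theorem Kind.path_to_ofLevel (X : Kind) : Relation.ReflTransGen Arrow X (ofLevel X.level) := by
  cases X
  case RE => exact .single .RE_RS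
  case E => exact .single .E_S
  all_goals exact .refl

theorem Kind.path_from_ofLevel (X : Kind) : Relation.ReflTransGen Arrow (ofLevel X.level) X := by
  cases X
  case RE => exact .single .RS_RE
  case E => exact .single .S_E
  all_goals exact .refl

theorem Kind.path_ofLevel {i j : ℕ} (h : i ≤ j) :
    Relation.ReflTransGen Arrow (ofLevel i) (ofLevel j) := by
  induction h with
  | refl => exact .refl
  | @step j _ ih =>
    refine ih.trans ?_
    match j with
    | 0 => exact .single .FE_FS
    | 1 => exact .single .FS_RS
    | 2 => exact .single .RS_S
    | _ + 3 => exact .refl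

/-- Composed with the arrows, an inclusion that descends in level would also put level `Y.level + 1`
into level `Y.level`; each of the three possible cases contradicts one of the counterexamples. -/
theorem not_included_of_level_lt {X Y : Kind} (h : Y.level < X.level) :
    ¬ Included.{u, v, w} X Y := by
  intro hXY
  have hi : Included.{u, v, w} (Kind.ofLevel (Y.level + 1)) (Kind.ofLevel Y.level) :=
    (included_of_path ((Kind.path_ofLevel h).trans X.path_from_ofLevel)).trans
      (hXY.trans (included_of_path Y.path_to_ofLevel))
  have hX : X.level ≤ 3 := by cases X <;> simp [Kind.level]
  obtain hY | hY | hY : Y.level = 0 ∨ Y.level = 1 ∨ Y.level = 2 := by omega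
  all_goals rw [hY] at hi
  · exact not_FS_subset_FE (hi symbols Set.univ isElementary_univ)
  · exact not_RE_subset_FS (RE_subset_RS.trans (hi symbols Set.univ isElementary_univ))
  · exact not_E_subset_RE ((S_eq_E isElementary_univ).superset.trans
      ((hi symbols Set.univ isElementary_univ).trans RS_subset_RE))

theorem included_iff_path (X Y : Kind) :
    Included.{u, v, w} X Y ↔ Relation.ReflTransGen Arrow X Y := by
  refine ⟨fun h => ?_, included_of_path⟩
  have hl : X.level ≤ Y.level := not_lt.1 fun hl => not_included_of_level_lt hl h
  exact X.path_to_ofLevel.trans ((Kind.path_ofLevel hl).trans Y.path_from_ofLevel)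

end Diagram

end SeparationClass

/-- For arbitrary signatures, the inclusions that do not mention computability; for effective
signatures, the whole diagram: an inclusion holds for all elementary classes exactly when it is
drawn (as a path of arrows). -/
theorem propositionP :
    (∀ (L : FirstOrder.Language.{u, v}) (𝒜 : Set (SeparationClass.Struc.{u, v, w} L)),
      SeparationClass.IsElementary 𝒜 →
        SeparationClass.FE 𝒜 ⊆ SeparationClass.FS 𝒜 ∧
        SeparationClass.FS 𝒜 ⊆ SeparationClass.S 𝒜 ∧
        SeparationClass.FE 𝒜 ⊆ SeparationClass.E 𝒜 ∧
        SeparationClass.S 𝒜 = SeparationClass.E 𝒜) ∧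
    (∀ (L : FirstOrder.Language.{u, v}) [SeparationClass.EffectiveSignature L]
      (𝒜 : Set (SeparationClass.Struc.{u, v, w} L)), SeparationClass.IsElementary 𝒜 →
        SeparationClass.RS 𝒜 = SeparationClass.RE 𝒜) ∧
    (∀ X Y : SeparationClass.Kind,
      (∀ (L : FirstOrder.Language.{u, v}) [SeparationClass.EffectiveSignature L]
        (𝒜 : Set (SeparationClass.Struc.{u, v, w} L)), SeparationClass.IsElementary 𝒜 →
          X.subclasses 𝒜 ⊆ Y.subclasses 𝒜) ↔
      Relation.ReflTransGen SeparationClass.Arrow X Y) := by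
  refine ⟨fun L 𝒜 h𝒜 => ⟨SeparationClass.FE_subset_FS, SeparationClass.FS_subset_S,
    SeparationClass.FE_subset_E h𝒜, SeparationClass.S_eq_E h𝒜⟩,
    fun L _ 𝒜 _ => SeparationClass.RS_eq_RE, SeparationClass.included_iff_path⟩
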